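/- Let $d\in\mathbb N$, $d\ge 2$, and let $\mathbb T^d=(\mathbb R/\mathbb Z)^d$ with normalised Lebesgue measure. For $f\in L_2(\mathbb T^d)$ put $\hat f_k=\int_{\mathbb T^d} f(x)e^{-2\pi i k\cdot x}\,dx$ and $$\|f|\mathcal H^{\alpha,\beta}\|^2=\sum_{k\in\mathbb Z^d}|\hat f_k|^2(1+\|k\|_2^2)^{\beta}\prod_{s=1}^d(1+|k_s|^2)^{\alpha},\qquad \mathcal H^{\alpha,\beta}(\mathbb T^d)=\{f\in L_2:\|f|\mathcal H^{\alpha,\beta}\|<\infty\},\qquad \mathcal H^\gamma_{\mathrm{mix}}(\mathbb T^d)=\mathcal H^{\gamma,0}(\mathbb T^d).$$ For $z\in\mathbb Z^d$, $M\in\mathbb N$ and a finite set $I\subset\mathbb Z^d$, the rank-1 lattice sampling operator is $$S_I^{\Lambda(z,M)}f=\sum_{k\in I}\Big(\frac1M\sum_{j=0}^{M-1}f\big(\tfrac jM z\big)e^{-2\pi i\frac jM k\cdot z}\Big)e^{2\pi i k\cdot x},$$ where $f$ is evaluated through its continuous representative. $\Lambda(z,M)$ is called a reconstructing rank-1 lattice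 for $I$ if $S_I^{\Lambda(z,M)}p=p$ for all trigonometric polynomials $p$ with frequencies in $I$. For real $R\ge1$ the dyadic hyperbolic cross is $$H_R^{d,0}=\bigcup_{j\in\mathbb N_0^d,\ \|j\|_1\le R+d-1}Q_{j_1}\times\cdots\times Q_{j_d},\qquad Q_0=\{-1,0,1\},\quad Q_j=\{k\in\mathbb Z:2^{j-1}+1\le|k|\le 2^j\}\ (j>0).$$ For a finite set $I\subset\mathbb Z^d$ let $\mathcal D(I)=\{h-h':h,h'\in I\}$. For $\kappa\in\mathbb R$ we say that $\Lambda(z,M)$ is *constructed by the CBC (component-by-component) strategy* for $I$ with constant $\kappa$ if there is a prime $P$ with $P>|\mathcal D(I)|/2$, $P>\max\{|k_s|:k\in\mathcal D(I),\,1\le s\le d\}$ and $P\le\kappa|\mathcal D(I)|$ such that $z\in\{0,\dots,P-1\}^d$; for every $s=1,\dots,d$ the lattice $\Lambda((z_1,\dots,z_s),P)$ is reconstructing for the projection of $I$ to the first $s$ coordinates; and $M\le P$ (the lattice size may be decreased at the end) with $\Lambda(z,M)$ reconstructing for $I$. **Theorem.** Let $\alpha>\frac12$, $\beta\le0$, $\gamma\ge0$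 with $\alpha+\beta>\max\{\gamma,\frac12\}$. (i) There are constants $c,C>0$ depending only on $d,\alpha,\beta,\gamma$ such that for every $R\ge1$ and every reconstructing rank-1 lattice $\Lambda(z,M)$ for $H_R^{d,0}$ $$c\,M^{-(\alpha+\beta-\gamma)/2}\le\big\|\mathrm{Id}-S^{\Lambda(z,M)}_{H_R^{d,0}}\,\big|\,\mathcal H^{\alpha,\beta}(\mathbb T^d)\to\mathcal H^\gamma_{\mathrm{mix}}(\mathbb T^d)\big\|\le C\,2^{-(\alpha+\beta-\gamma)R}\begin{cases}R^{(d-1)/2}&:\beta=0,\\1&:\beta<0.\end{cases}$$ (ii) For every $\kappa$ there is a constant $C>0$ depending only on $d,\alpha,\beta,\gamma,\kappa$ such that for every $R\ge1$ and every lattice $\Lambda(z,M)$ constructed by the CBC strategy for $H_R^{d,0}$ with constant $\kappa$, both the right-hand factor $2^{-(\alpha+\beta-\gamma)R}R^{(d-1)/2}$ (if $\beta=0$), respectively $2^{-(\alpha+\beta-\gamma)R}$ (if $\beta<0$), and the operator norm in (i) are at most $$C\,M^{-(\alpha+\beta-\gamma)/2}(\log M)^{\frac{d-2}{2}(\alpha+\beta-\gamma)}\begin{cases}(\log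 M)^{(d-1)/2}&:\beta=0,\\1&:\beta<0.\end{cases}$$ (iii) For every $\kappa\ge2$ and every $R\ge1$ there is a lattice constructed by the CBC strategy for $H_R^{d,0}$ with constant $\kappa$. -/

import Mathlib

open MeasureTheory

noncomputable section

/-- The `d`-dimensional torus `(ℝ/ℤ)^d`. -/
abbrev Torus (d : ℕ) : Type := UnitAddTorus (Fin d)

/-- The normalised Haar (Lebesgue) measure on the torus. -/
abbrev torusMeasure (d : ℕ) : Measure (Torus d) :=
  Measure.pi fun _ : Fin d => (AddCircle.haarAddCircle : Measure UnitAddCircle)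

/-- The space `L_2(𝕋^d)`. -/
abbrev TorusL2 (d : ℕ) : Type := Lp ℂ 2 (torusMeasure d)

/-- The `k`-th Fourier coefficient `∫ f(x) e^{-2πi k·x} dx`. -/
def fourierCoefficient {d : ℕ} (f : Torus d → ℂ) (k : Fin d → ℤ) : ℂ :=
  ∫ x, UnitAddTorus.mFourier (-k) x * f x ∂torusMeasure d

/-- The class in `L_2(𝕋^d)` of a continuous function. -/
def toL2 {d : ℕ} (g : C(Torus d, ℂ)) : TorusL2 d :=
  ContinuousMap.toLp (E := ℂ) 2 (torusMeasure d) ℂ g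

/-- The squared weight `(1 + ‖k‖₂²)^β ∏ₛ (1 + |kₛ|²)^α`. -/
def sobolevWeight {d : ℕ} (α β : ℝ) (k : Fin d → ℤ) : ℝ :=
  (1 + ∑ s, (k s : ℝ) ^ 2) ^ β * ∏ s, (1 + (k s : ℝ) ^ 2) ^ α

/-- The norm of `f ∈ L_2(𝕋^d)` in the hybrid Sobolev space `H^{α,β}(𝕋^d)`; it is `∞` exactly when
`f` does not belong to that space. The mixed space `H^γ_mix` is `H^{γ,0}`. -/
def sobolevNorm {d : ℕ} (α β : ℝ) (f : TorusL2 d) : ENNReal :=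
  (∑' k : Fin d → ℤ,
    ENNReal.ofReal (sobolevWeight α β k) * ‖fourierCoefficient f k‖ₑ ^ 2) ^ (1 / 2 : ℝ)

open Classical in
/-- The continuous representative of an element of `L_2(𝕋^d)` (and `0` if there is none). Point
evaluations of `L_2` elements always refer to it. -/
def continuousRep {d : ℕ} (f : TorusL2 d) : C(Torus d, ℂ) :=
  if h : ∃ g : C(Torus d, ℂ), toL2 g = f then h.choose else 0

/-- The node `(j / M) z mod 1` of the rank-1 lattice `Λ(z, M)`. -/
def latticeNode {d : ℕ} (z : Fin d → ℤ) (M j : ℕ) : Torus d :=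
  fun s => (((j : ℝ) / (M : ℝ) * (z s : ℝ) : ℝ) : UnitAddCircle)

/-- The lattice-rule approximation `(1/M) ∑_{j<M} f((j/M)z) e^{-2πi (j/M) k·z}` of the `k`-th Fourier
coefficient. -/
def latticeCoefficient {d : ℕ} (z : Fin d → ℤ) (M : ℕ) (f : C(Torus d, ℂ)) (k : Fin d → ℤ) : ℂ :=
  (1 / (M : ℂ)) * ∑ j ∈ Finset.range M,
    f (latticeNode z M j) * UnitAddTorus.mFourier (-k) (latticeNode z M j)

/-- The rank-1 lattice sampling operator `S_I^{Λ(z,M)}`. -/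
def latticeSampling {d : ℕ} (z : Fin d → ℤ) (M : ℕ) (I : Finset (Fin d → ℤ))
    (f : C(Torus d, ℂ)) : C(Torus d, ℂ) :=
  ∑ k ∈ I, latticeCoefficient z M f k • UnitAddTorus.mFourier k

/-- `Λ(z, M)` is a reconstructing rank-1 lattice for `I`: the sampling operator reproduces all
trigonometric polynomials with frequencies in `I`. -/
def IsReconstructing {d : ℕ} (z : Fin d → ℤ) (M : ℕ) (I : Finset (Fin d → ℤ)) : Prop :=
  ∀ p ∈ Submodule.span ℂ (UnitAddTorus.mFourier '' (I : Set (Fin d → ℤ))),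
    latticeSampling z M I p = p

/-- The norm of `Id - S_I^{Λ(z,M)}` as an operator from `H^{α,β}(𝕋^d)` to `H^γ_mix(𝕋^d)`, that is,
the supremum of `‖f - S f | H^γ_mix‖` over the unit ball of `H^{α,β}`. -/
def samplingError {d : ℕ} (α β γ : ℝ) (z : Fin d → ℤ) (M : ℕ) (I : Finset (Fin d → ℤ)) : ENNReal :=
  ⨆ (f : TorusL2 d) (_ : sobolevNorm α β f ≤ 1),
    sobolevNorm γ 0 (f - toL2 (latticeSampling z M I (continuousRep f)))

/-- The dyadic blocks `Q_0 = {-1,0,1}` and `Q_j = {k : 2^(j-1) + 1 ≤ |k| ≤ 2^j}` for `j > 0`. -/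
def dyadicBlock (j : ℕ) : Finset ℤ :=
  if j = 0 then {-1, 0, 1}
  else Finset.Icc (-2 ^ j) (-2 ^ (j - 1) - 1) ∪ Finset.Icc (2 ^ (j - 1) + 1) (2 ^ j)

/-- The set `J_R^{d,0}` of all `j ∈ ℕ₀^d` with `‖j‖₁ ≤ R + d - 1`. -/
def dyadicIndices (d : ℕ) (R : ℝ) : Finset (Fin d → ℕ) :=
  (Fintype.piFinset fun _ => Finset.range (⌊R + d - 1⌋₊ + 1)).filter
    fun j => ∑ s, (j s : ℝ) ≤ R + d - 1

/-- The dyadic hyperbolic cross `H_R^{d,0}`. -/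
def hyperbolicCross (d : ℕ) (R : ℝ) : Finset (Fin d → ℤ) :=
  (dyadicIndices d R).biUnion fun j => Fintype.piFinset fun s => dyadicBlock (j s)

/-- The range bound in `dyadicIndices` only serves to make the set finite. -/
theorem mem_dyadicIndices {d : ℕ} {R : ℝ} {j : Fin d → ℕ} :
    j ∈ dyadicIndices d R ↔ ∑ s, (j s : ℝ) ≤ R + d - 1 := by
  unfold dyadicIndices
  rw [Finset.mem_filter, Fintype.mem_piFinset, and_iff_right_iff_imp]
  intro h s
  rw [Finset.mem_range, Nat.lt_succ_iff]
  apply Nat.le_floor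
  exact (Finset.single_le_sum (f := fun s => (j s : ℝ)) (fun i _ => Nat.cast_nonneg _)
    (Finset.mem_univ s)).trans h

/-- The difference set `D(I) = {h - h' : h, h' ∈ I}`. -/
def differenceSet {d : ℕ} (I : Finset (Fin d → ℤ)) : Finset (Fin d → ℤ) :=
  Finset.image₂ (fun h h' => h - h') I I

/-- The projection of `I` to the first `s` coordinates. -/
def projectFirst {d : ℕ} (s : ℕ) (hs : s ≤ d) (I : Finset (Fin d → ℤ)) : Finset (Fin s → ℤ) :=
  I.image fun k i => k (Fin.castLE hs i)

/-- `Λ(z, M)` is a possible result of the component-by-component construction for `I` with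
oversampling constant `κ`. One starts with a prime lattice size `P` that exceeds `|D(I)|/2` and all
`|k_s|`, `k ∈ D(I)`, and is at most `κ |D(I)|`. The components `z_1, …, z_d ∈ {0, …, P-1}` are chosen
one after the other such that `Λ((z_1,…,z_s), P)` is reconstructing for the projection of `I` to the
first `s` coordinates, `s = 1, …, d`. Finally the lattice size may be decreased from `P` to some
`M ≤ P` as long as the lattice stays reconstructing for `I`. -/
def IsCBCLattice {d : ℕ} (κ : ℝ) (I : Finset (Fin d → ℤ)) (z : Fin d → ℤ) (M : ℕ) : Prop :=
  ∃ P : ℕ, P.Prime ∧ (differenceSet I).card < 2 * P ∧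
    (∀ k ∈ differenceSet I, ∀ s, |k s| < (P : ℤ)) ∧
    (P : ℝ) ≤ κ * ((differenceSet I).card : ℝ) ∧
    (∀ s, 0 ≤ z s ∧ z s < (P : ℤ)) ∧
    (∀ (s : ℕ) (hs : s ≤ d), 1 ≤ s →
      IsReconstructing (fun i : Fin s => z (Fin.castLE hs i)) P (projectFirst s hs I)) ∧
    M ≤ P ∧ IsReconstructing z M I

/-- The rate `2^{-(α+β-γ)R} R^{(d-1)/2}` if `β = 0` and `2^{-(α+β-γ)R}` otherwise. -/
def refinementRate (d : ℕ) (α β γ R : ℝ) : ℝ :=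
  (2 : ℝ) ^ (-(α + β - γ) * R) * (if β = 0 then R ^ (((d : ℝ) - 1) / 2) else 1)

/-- The rate `M^{-(α+β-γ)/2} (log M)^{(d-2)(α+β-γ)/2}`, times `(log M)^{(d-1)/2}` if `β = 0`. -/
def latticeSizeRate (d : ℕ) (α β γ : ℝ) (M : ℕ) : ℝ :=
  (M : ℝ) ^ (-(α + β - γ) / 2) * Real.log M ^ (((d : ℝ) - 2) / 2 * (α + β - γ)) *
    (if β = 0 then Real.log M ^ (((d : ℝ) - 1) / 2) else 1)

end

/-! Call `h` dual if `M` divides `h·z`. Exponentials whose frequencies differ by a dual vector agree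
at all nodes, so the `k`-th lattice coefficient is the sum of the Fourier coefficients over the
coset of `k` modulo the dual lattice (`hasSum_latticeCoefficient`). Reconstruction on `I` means that
distinct points of `I` lie in distinct cosets. The squared error thus has a truncation part, `k ∉
I`, and an aliasing part, `k ∈ I`. Weighted Cauchy–Schwarz reduces the latter to sums of inverse
weights over the aliases of `k`; disjointness of the cosets keeps the remaining factors summable to
at most the squared norm of `f` (`sobolevNorm_sub_latticeSampling_le`).

Let `T = ⌊R + d - 1⌋`. Outside the cross the ratio of the weights is at most a constant times
`4^{-(α+β-γ)T}`. For aliasing, a box with sides `2^{u_s}`, `‖u‖₁ = T`, holds at most one point of a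
coset, since two would differ by a nonzero dual vector in the cross. Hence a block of level `‖j‖₁ ≥
T` holds at most `3^d 2^{‖j‖₁ - T}` of them (`card_mul_two_pow_le`). For `β < 0` the inverse weights
decay away from the coordinate axes and the blocks of one level sum up without a logarithm; for `β =
0` all blocks of a level count alike, which costs `T^{d-1}` (`exists_exponent_bound`).

For the lower bound, the pigeonhole principle in two coordinates gives a nonzero dual vector with
entries at most `√M`, hence a difference of two exponentials on the axes that vanishes at every node
(`le_samplingError`). For the rate in `M`, the difference set has at most `C T^{d-2} 4^T` elements,
and `M > 2^T` turns `R` into `log M`. Existence combines Bertrand's postulate with a greedy choice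
of the components. -/

open scoped ENNReal

noncomputable section

/-! ### Fourier coefficients and continuous representatives -/

open UnitAddTorus in
/-- The Fourier basis of `L_2(𝕋^d)`. -/
def torusBasis (d : ℕ) : HilbertBasis (Fin d → ℤ) ℂ (TorusL2 d) :=
  mFourierBasis (d := Fin d)

theorem torusBasis_apply {d : ℕ} (k : Fin d → ℤ) :
    torusBasis d k = toL2 (UnitAddTorus.mFourier k) :=
  congrFun (UnitAddTorus.coe_mFourierBasis (d := Fin d)) k

theorem torusBasis_repr {d : ℕ} (f : TorusL2 d) (k : Fin d → ℤ) :
    (torusBasis d).repr f k = fourierCoefficient f k :=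
  UnitAddTorus.mFourierBasis_repr (d := Fin d) f k

theorem fourierCoefficient_eq_inner {d : ℕ} (f : TorusL2 d) (k : Fin d → ℤ) :
    fourierCoefficient f k = inner ℂ (torusBasis d k) f := by
  rw [← torusBasis_repr, HilbertBasis.repr_apply_apply]

/-- `toL2` as a continuous linear map. -/
def toL2CLM (d : ℕ) : C(Torus d, ℂ) →L[ℂ] TorusL2 d :=
  ContinuousMap.toLp (E := ℂ) 2 (torusMeasure d) ℂ

theorem toL2CLM_apply {d : ℕ} (g : C(Torus d, ℂ)) : toL2CLM d g = toL2 g := rfl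

theorem toL2_injective (d : ℕ) : Function.Injective (toL2 (d := d)) :=
  ContinuousMap.toLp_injective (𝕜 := ℂ) (p := 2) (torusMeasure d)

theorem fourierCoefficient_sub {d : ℕ} (f g : TorusL2 d) (k : Fin d → ℤ) :
    fourierCoefficient (f - g : TorusL2 d) k = fourierCoefficient f k - fourierCoefficient g k := by
  simp only [fourierCoefficient_eq_inner, inner_sub_right]

theorem fourierCoefficient_smul {d : ℕ} (c : ℂ) (f : TorusL2 d) (k : Fin d → ℤ) :
    fourierCoefficient (c • f : TorusL2 d) k = c * fourierCoefficient f k := by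
  simp only [fourierCoefficient_eq_inner, inner_smul_right]

theorem fourierCoefficient_mFourier {d : ℕ} (h k : Fin d → ℤ) :
    fourierCoefficient (toL2 (UnitAddTorus.mFourier h)) k = if k = h then 1 else 0 := by
  rw [fourierCoefficient_eq_inner, ← torusBasis_apply]
  exact orthonormal_iff_ite.1 (torusBasis d).orthonormal k h

theorem fourierCoefficient_sum {d : ℕ} (I : Finset (Fin d → ℤ)) (c : (Fin d → ℤ) → ℂ)
    (k : Fin d → ℤ) :
    fourierCoefficient (toL2 (∑ h ∈ I, c h • UnitAddTorus.mFourier h)) k =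
      if k ∈ I then c k else 0 := by
  rw [fourierCoefficient_eq_inner, ← toL2CLM_apply, map_sum, inner_sum]
  simp only [map_smul, inner_smul_right, toL2CLM_apply, ← fourierCoefficient_eq_inner,
    fourierCoefficient_mFourier]
  simp

/-- The series converges uniformly, and its continuous limit has class `f` by uniqueness of sums in
`L_2`. Injectivity of `toL2` identifies this limit with the chosen representative, so point
evaluations may be taken term by term. -/
theorem hasSum_fourier_of_summable {d : ℕ} {f : TorusL2 d}
    (hf : Summable fun k => ‖fourierCoefficient f k‖) :
    HasSum (fun k => fourierCoefficient f k • UnitAddTorus.mFourier k) (continuousRep f) ∧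
      toL2 (continuousRep f) = f := by
  have hs : Summable fun k => fourierCoefficient f k • (UnitAddTorus.mFourier k : C(Torus d, ℂ)) := by
    refine Summable.of_norm ?_
    simpa only [norm_smul, UnitAddTorus.mFourier_norm, mul_one] using hf
  obtain ⟨g, hg⟩ := hs
  have h1 := (torusBasis d).hasSum_repr f
  have h2 := (toL2CLM d).hasSum hg
  have hgf : toL2 g = f := by
    refine HasSum.unique (f := fun k => (torusBasis d).repr f k • torusBasis d k) ?_ h1
    simpa only [torusBasis_apply, torusBasis_repr, map_smul, toL2CLM_apply] using h2
  have hex : ∃ g : C(Torus d, ℂ), toL2 g = f := ⟨g, hgf⟩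
  have hrep : toL2 (continuousRep f) = f := by
    rw [continuousRep, dif_pos hex]
    exact hex.choose_spec
  have : continuousRep f = g := toL2_injective d (hrep.trans hgf.symm)
  exact ⟨this ▸ hg, hrep⟩

theorem continuousRep_toL2 {d : ℕ} (g : C(Torus d, ℂ)) : continuousRep (toL2 g) = g := by
  have hex : ∃ g' : C(Torus d, ℂ), toL2 g' = toL2 g := ⟨g, rfl⟩
  apply toL2_injective d
  rw [continuousRep, dif_pos hex]
  exact hex.choose_spec

/-! ### Lattice sums -/

open Complex in
theorem mFourier_latticeNode {d : ℕ} (z : Fin d → ℤ) (M j : ℕ) (k : Fin d → ℤ) :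
    UnitAddTorus.mFourier k (latticeNode z M j) =
      exp (2 * Real.pi * I * ((∑ s, k s * z s : ℤ) : ℂ) / M) ^ j := by
  simp only [UnitAddTorus.mFourier, latticeNode, ContinuousMap.coe_mk]
  rw [← Complex.exp_nat_mul]
  rw [Finset.prod_congr rfl fun s _ => fourier_coe_apply (T := 1) (n := k s)
    (x := (j : ℝ) / (M : ℝ) * (z s : ℝ)), ← Complex.exp_sum]
  congr 1
  push_cast
  rw [Finset.mul_sum, Finset.sum_div, Finset.mul_sum]
  refine Finset.sum_congr rfl fun s _ => ?_
  ring

open Complex in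
theorem sum_exp_pow {M : ℕ} (hM : 0 < M) (n : ℤ) :
    ∑ j ∈ Finset.range M, exp (2 * Real.pi * I * (n : ℂ) / M) ^ j =
      if (M : ℤ) ∣ n then (M : ℂ) else 0 := by
  have hM0 : (M : ℂ) ≠ 0 := by exact_mod_cast hM.ne'
  have hpi : (2 * Real.pi * I : ℂ) ≠ 0 := by simp [Real.pi_ne_zero]
  have hone : exp (2 * Real.pi * I * (n : ℂ) / M) = 1 ↔ (M : ℤ) ∣ n := by
    rw [Complex.exp_eq_one_iff]
    constructor
    · rintro ⟨m, hm⟩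
      refine ⟨m, ?_⟩
      field_simp at hm
      have : (n : ℂ) = ((M * m : ℤ) : ℂ) := by push_cast; linear_combination hm
      exact_mod_cast this
    · rintro ⟨m, rfl⟩
      refine ⟨m, ?_⟩
      push_cast
      field_simp
  split_ifs with h
  · simp [hone.2 h]
  · have hne := fun h' => h (hone.1 h')
    rw [geom_sum_eq hne, ← Complex.exp_nat_mul]
    have : (M : ℂ) * (2 * Real.pi * I * (n : ℂ) / M) = n * (2 * Real.pi * I) := by
      field_simp
    rw [this, Complex.exp_int_mul_two_pi_mul_I]
    simp

/-- At the nodes the product of the two characters runs through the powers of one `M`-th root of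
unity, whose average is 1 or 0. -/
theorem latticeCoefficient_mFourier {d : ℕ} (z : Fin d → ℤ) {M : ℕ} (hM : 0 < M)
    (h k : Fin d → ℤ) :
    latticeCoefficient z M (UnitAddTorus.mFourier h) k =
      if (M : ℤ) ∣ ∑ s, (h s - k s) * z s then 1 else 0 := by
  have hM0 : (M : ℂ) ≠ 0 := by exact_mod_cast hM.ne'
  rw [latticeCoefficient]
  rw [Finset.sum_congr rfl fun j _ => (UnitAddTorus.mFourier_add (m := h) (n := -k)
    (x := latticeNode z M j)).symm]
  simp only [mFourier_latticeNode]
  rw [sum_exp_pow hM]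
  have : ∑ s, (h + -k) s * z s = ∑ s, (h s - k s) * z s := by
    simp [sub_eq_add_neg]
  rw [this]
  split_ifs <;> simp [hM0]

/-- The `k`-th lattice coefficient as a continuous linear functional. -/
def latticeCoefficientCLM {d : ℕ} (z : Fin d → ℤ) (M : ℕ) (k : Fin d → ℤ) :
    C(Torus d, ℂ) →L[ℂ] ℂ :=
  (1 / (M : ℂ)) • ∑ j ∈ Finset.range M,
    (UnitAddTorus.mFourier (-k) (latticeNode z M j)) •
      ContinuousMap.evalCLM ℂ (latticeNode z M j)

theorem latticeCoefficientCLM_apply {d : ℕ} (z : Fin d → ℤ) (M : ℕ) (k : Fin d → ℤ)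
    (f : C(Torus d, ℂ)) : latticeCoefficientCLM z M k f = latticeCoefficient z M f k := by
  simp [latticeCoefficientCLM, latticeCoefficient, mul_comm, ContinuousMap.evalCLM]

/-- The aliasing formula: a continuous functional is applied to the uniformly convergent Fourier
series. -/
theorem hasSum_latticeCoefficient {d : ℕ} (z : Fin d → ℤ) {M : ℕ} (hM : 0 < M) {f : TorusL2 d}
    (hf : Summable fun k => ‖fourierCoefficient f k‖) (k : Fin d → ℤ) :
    HasSum (fun h => if (M : ℤ) ∣ ∑ s, (h s - k s) * z s then fourierCoefficient f h else 0)
      (latticeCoefficient z M (continuousRep f) k) := by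
  have h := (latticeCoefficientCLM z M k).hasSum (hasSum_fourier_of_summable hf).1
  simpa only [map_smul, latticeCoefficientCLM_apply, latticeCoefficient_mFourier z hM,
    smul_eq_mul, mul_ite, mul_one, mul_zero] using h

theorem isReconstructing_of_injective {d : ℕ} {z : Fin d → ℤ} {M : ℕ} (hM : 0 < M)
    {I : Finset (Fin d → ℤ)}
    (h : ∀ k ∈ I, ∀ k' ∈ I, (M : ℤ) ∣ ∑ s, (k s - k' s) * z s → k = k') :
    IsReconstructing z M I := by
  intro p hp
  let S : C(Torus d, ℂ) →ₗ[ℂ] C(Torus d, ℂ) :=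
    ∑ k ∈ I, (latticeCoefficientCLM z M k).toLinearMap.smulRight (UnitAddTorus.mFourier k)
  have hS : ∀ g, latticeSampling z M I g = S g := by
    intro g
    simp [S, latticeSampling, latticeCoefficientCLM_apply]
  rw [hS]
  have : Set.EqOn S (LinearMap.id : C(Torus d, ℂ) →ₗ[ℂ] C(Torus d, ℂ))
      (UnitAddTorus.mFourier '' (I : Set (Fin d → ℤ))) := by
    rintro _ ⟨k, hk, rfl⟩
    rw [← hS, latticeSampling, LinearMap.id_apply, Finset.sum_eq_single k]
    · rw [latticeCoefficient_mFourier z hM]; simp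
    · intro k' hk' hne
      rw [latticeCoefficient_mFourier z hM, if_neg]
      · ext x; exact zero_mul _
      exact fun hd => hne (h _ hk _ hk' hd).symm
    · exact fun hk' => absurd hk hk'
  exact LinearMap.eqOn_span this hp

/-- For `M = 0` the sampling operator is zero and cannot reproduce an exponential, which has norm 1.
-/
theorem IsReconstructing.pos {d : ℕ} {z : Fin d → ℤ} {M : ℕ} {I : Finset (Fin d → ℤ)}
    (h : IsReconstructing z M I) (hI : I.Nonempty) : 0 < M := by
  obtain ⟨k, hk⟩ := hI
  rcases Nat.eq_zero_or_pos M with rfl | hM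
  · have := h _ (Submodule.subset_span ⟨k, hk, rfl⟩)
    have h0 : latticeSampling z 0 I (UnitAddTorus.mFourier k) = 0 := by
      simp only [latticeSampling, latticeCoefficient, Finset.range_zero, Finset.sum_empty, mul_zero]
      exact Finset.sum_eq_zero fun _ _ => by ext x; exact zero_mul _
    rw [h0] at this
    have h1 := UnitAddTorus.mFourier_norm (n := k)
    rw [← this] at h1
    simp at h1
  · exact hM

/-- If `k` and `k'` alias, sampling the exponential of frequency `k` produces coefficient 1 at `k'`
as well. -/
theorem IsReconstructing.eq_of_dvd {d : ℕ} {z : Fin d → ℤ} {M : ℕ} {I : Finset (Fin d → ℤ)}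
    (h : IsReconstructing z M I) {k k' : Fin d → ℤ} (hk : k ∈ I) (hk' : k' ∈ I)
    (hd : (M : ℤ) ∣ ∑ s, (k s - k' s) * z s) : k = k' := by
  have hM := h.pos ⟨k, hk⟩
  have h1 := congrArg (fun g => fourierCoefficient (toL2 g) k')
    (h _ (Submodule.subset_span ⟨k, hk, rfl⟩))
  simp only [latticeSampling, fourierCoefficient_sum, if_pos hk', fourierCoefficient_mFourier,
    latticeCoefficient_mFourier z hM, if_pos hd] at h1
  by_contra hne
  rw [if_neg (Ne.symm hne)] at h1
  exact one_ne_zero h1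

/-! ### Cauchy–Schwarz and the splitting into truncation and aliasing error -/

theorem ENNReal.tsum_mul_sq_le {ι : Type*} (a b : ι → ℝ≥0∞) :
    (∑' i, a i * b i) ^ 2 ≤ (∑' i, a i ^ 2) * ∑' i, b i ^ 2 := by
  let _ : MeasurableSpace ι := ⊤
  have h := ENNReal.lintegral_mul_le_Lp_mul_Lq (Measure.count : Measure ι)
    Real.HolderConjugate.two_two (f := a) (g := b) measurable_from_top.aemeasurable
    measurable_from_top.aemeasurable
  simp only [lintegral_count, Pi.mul_apply, ENNReal.rpow_two] at h
  calc (∑' i, a i * b i) ^ 2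
      ≤ ((∑' i, a i ^ 2) ^ (1 / 2 : ℝ) * (∑' i, b i ^ 2) ^ (1 / 2 : ℝ)) ^ 2 := by gcongr
    _ = _ := by
      rw [mul_pow, ← ENNReal.rpow_two, ← ENNReal.rpow_two, ← ENNReal.rpow_mul, ← ENNReal.rpow_mul]
      norm_num

theorem ENNReal.tsum_weighted_sq_le {ι : Type*} (w : ι → ℝ) (hw : ∀ i, 0 < w i) (p : ι → Prop)
    [DecidablePred p] (a : ι → ℝ≥0∞) :
    (∑' i, if p i then a i else 0) ^ 2 ≤
      (∑' i, if p i then (ENNReal.ofReal (w i))⁻¹ else 0) *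
        ∑' i, if p i then ENNReal.ofReal (w i) * a i ^ 2 else 0 := by
  have h0 : ∀ i, ENNReal.ofReal (w i) ≠ 0 := fun i => by simp [hw i]
  refine le_trans (le_of_eq ?_) (ENNReal.tsum_mul_sq_le
    (fun i => if p i then (ENNReal.ofReal (w i)) ^ (-(1 / 2) : ℝ) else 0)
    (fun i => if p i then (ENNReal.ofReal (w i)) ^ (1 / 2 : ℝ) * a i else 0) |>.trans (le_of_eq ?_))
  · congr 2
    ext i
    split_ifs
    · rw [← mul_assoc, ← ENNReal.rpow_add _ _ (h0 i) ENNReal.ofReal_ne_top]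
      simp
    · simp
  · congr 2 <;> ext i <;> split_ifs
    · rw [← ENNReal.rpow_two, ← ENNReal.rpow_mul, ← ENNReal.rpow_neg_one]
      norm_num
    · simp
    · rw [mul_pow, ← ENNReal.rpow_two, ← ENNReal.rpow_mul]
      norm_num
    · simp

theorem sobolevWeight_pos {d : ℕ} (α β : ℝ) (k : Fin d → ℤ) : 0 < sobolevWeight α β k := by
  unfold sobolevWeight
  refine mul_pos (Real.rpow_pos_of_pos ?_ _) (Finset.prod_pos fun s _ => Real.rpow_pos_of_pos ?_ _)
  · have : 0 ≤ ∑ s, (k s : ℝ) ^ 2 := Finset.sum_nonneg fun _ _ => sq_nonneg _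
    linarith
  · positivity

theorem summable_fourierCoefficient {d : ℕ} {α β : ℝ}
    (hsum : ∑' k : Fin d → ℤ, (ENNReal.ofReal (sobolevWeight α β k))⁻¹ ≠ ∞) {f : TorusL2 d}
    (hf : ∑' k : Fin d → ℤ,
      ENNReal.ofReal (sobolevWeight α β k) * ‖fourierCoefficient f k‖ₑ ^ 2 ≠ ∞) :
    Summable fun k => ‖fourierCoefficient f k‖ := by
  have h := ENNReal.tsum_weighted_sq_le (fun k : Fin d → ℤ => sobolevWeight α β k)
    (sobolevWeight_pos α β) (fun _ => True) (fun k => ‖fourierCoefficient f k‖ₑ)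
  simp only [if_true] at h
  have h1 : (∑' k, ‖fourierCoefficient f k‖ₑ) ≠ ∞ := by
    intro h2
    rw [h2] at h
    exact (ENNReal.mul_ne_top hsum hf) (top_le_iff.1 (by simpa using h))
  exact tsum_enorm_ne_top_iff_summable_norm.1 h1

/-- `h1` controls truncation and `h2` aliasing; each contributes at most `E` to the squared error,
whence `2 * E`. -/
theorem sobolevNorm_sub_latticeSampling_le {d : ℕ} {α β γ : ℝ} {z : Fin d → ℤ} {M : ℕ} (hM : 0 < M)
    {I : Finset (Fin d → ℤ)}
    (hI : ∀ k ∈ I, ∀ k' ∈ I, (M : ℤ) ∣ ∑ s, (k s - k' s) * z s → k = k')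
    (hsum : ∑' k : Fin d → ℤ, (ENNReal.ofReal (sobolevWeight α β k))⁻¹ ≠ ∞) {E : ℝ≥0∞}
    (h1 : ∀ k ∉ I, ENNReal.ofReal (sobolevWeight γ 0 k) ≤ E * ENNReal.ofReal (sobolevWeight α β k))
    (h2 : ∀ k ∈ I, ENNReal.ofReal (sobolevWeight γ 0 k) *
      (∑' h : Fin d → ℤ, if h ≠ k ∧ (M : ℤ) ∣ ∑ s, (h s - k s) * z s then
        (ENNReal.ofReal (sobolevWeight α β h))⁻¹ else 0) ≤ E)
    {f : TorusL2 d} (hf : sobolevNorm α β f ≤ 1) :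
    sobolevNorm γ 0 (f - toL2 (latticeSampling z M I (continuousRep f))) ≤ (2 * E) ^ (1 / 2 : ℝ) := by
  set w : (Fin d → ℤ) → ℝ≥0∞ := fun k => ENNReal.ofReal (sobolevWeight α β k) with hw
  set F := fourierCoefficient f with hF
  have hle : ∑' k, w k * ‖F k‖ₑ ^ 2 ≤ 1 := by
    have := ENNReal.rpow_le_rpow hf (show (0 : ℝ) ≤ 2 by norm_num)
    rw [sobolevNorm, ← ENNReal.rpow_mul] at this
    simpa using this
  have hsm := summable_fourierCoefficient hsum (f := f) (ne_top_of_le_ne_top ENNReal.one_ne_top hle)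
  let P : (Fin d → ℤ) → (Fin d → ℤ) → Prop := fun k h => (M : ℤ) ∣ ∑ s, (h s - k s) * z s
  let B : (Fin d → ℤ) → ℝ≥0∞ := fun k => ∑' h, if h ≠ k ∧ P k h then w h * ‖F h‖ₑ ^ 2 else 0
  have halias : ∀ k, ‖F k - latticeCoefficient z M (continuousRep f) k‖ₑ ≤
      ∑' h, if h ≠ k ∧ P k h then ‖F h‖ₑ else 0 := by
    intro k
    have hs := hasSum_latticeCoefficient z hM hsm k
    have hk : HasSum (fun h => if h = k then F h else 0) (F k) := by
      refine (hasSum_ite_eq k (F k)).congr_fun fun h => ?_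
      split_ifs with hh
      · rw [hh]
      · rfl
    have h3 := hk.sub hs
    have h4 : (fun h => (if h = k then F h else 0) - if P k h then F h else 0) =
        fun h => -(if h ≠ k ∧ P k h then F h else 0) := by
      ext h
      by_cases hh : h = k
      · subst hh; simp [P]
      · simp [hh]
    have h5 : F k - latticeCoefficient z M (continuousRep f) k =
        ∑' h, -(if h ≠ k ∧ P k h then F h else 0) := by
      rw [← h4]; exact h3.tsum_eq.symm
    rw [h5]
    refine (enorm_tsum_le_tsum_enorm ).trans (ENNReal.tsum_le_tsum fun h => ?_)
    split_ifs <;> simp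
  have hterm : ∀ k, ENNReal.ofReal (sobolevWeight γ 0 k) *
      ‖fourierCoefficient (f - toL2 (latticeSampling z M I (continuousRep f)) : TorusL2 d) k‖ₑ ^ 2 ≤
      E * (if k ∈ I then B k else 0) + E * (w k * ‖F k‖ₑ ^ 2) := by
    intro k
    rw [fourierCoefficient_sub, latticeSampling, fourierCoefficient_sum]
    by_cases hk : k ∈ I
    · rw [if_pos hk, if_pos hk]
      refine le_trans ?_ le_self_add
      refine (mul_le_mul_right (pow_le_pow_left₀ zero_le (halias k) 2) _).trans ?_
      refine (mul_le_mul_right (ENNReal.tsum_weighted_sq_le (fun k : Fin d → ℤ => sobolevWeight α β k)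
        (sobolevWeight_pos α β) (fun h => h ≠ k ∧ P k h) (fun h => ‖F h‖ₑ)) _).trans ?_
      rw [← mul_assoc]
      exact mul_le_mul_left (h2 k hk) _
    · rw [if_neg hk, if_neg hk, mul_zero, zero_add, sub_zero, ← mul_assoc]
      exact mul_le_mul_left (h1 k hk) _
  -- After exchanging the sums, each `h` is counted for at most one `k ∈ I`: two such `k` would
  -- alias each other.
  have hB : ∑' k, (if k ∈ I then B k else 0) ≤ 1 := by
    have e1 : ∀ k, (if k ∈ I then B k else 0) =
        ∑' h, if k ∈ I ∧ h ≠ k ∧ P k h then w h * ‖F h‖ₑ ^ 2 else 0 := by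
      intro k
      by_cases hk : k ∈ I <;> simp [hk, B]
    simp_rw [e1]
    rw [ENNReal.tsum_comm]
    refine le_trans (ENNReal.tsum_le_tsum fun h => ?_) hle
    by_cases hex : ∃ k0 ∈ I, P k0 h
    · obtain ⟨k0, hk0, hP0⟩ := hex
      rw [tsum_eq_single k0]
      · split_ifs <;> simp
      · intro k hk
        rw [if_neg]
        rintro ⟨hkI, -, hPk⟩
        apply hk
        apply hI k hkI k0 hk0
        have := dvd_sub hP0 hPk
        rw [← Finset.sum_sub_distrib] at this
        refine this.trans (dvd_of_eq (Finset.sum_congr rfl fun s _ => ?_))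
        ring
    · have : ∀ k, (if k ∈ I ∧ h ≠ k ∧ P k h then w h * ‖F h‖ₑ ^ 2 else 0) = 0 := fun k =>
        if_neg fun hk => hex ⟨k, hk.1, hk.2.2⟩
      simp [this]
  rw [sobolevNorm]
  refine ENNReal.rpow_le_rpow ?_ (by norm_num)
  refine (ENNReal.tsum_le_tsum hterm).trans ?_
  rw [ENNReal.tsum_add, ENNReal.tsum_mul_left, ENNReal.tsum_mul_left, two_mul]
  exact add_le_add (mul_le_of_le_one_right' hB) (mul_le_of_le_one_right' hle)

/-! ### Dyadic levels and the hyperbolic cross -/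

/-- The index of the dyadic block containing an integer. -/
def dyadicLevel (n : ℤ) : ℕ := Nat.clog 2 n.natAbs

/-- The level `‖j‖₁` of the dyadic block `Q_{j_1} × ⋯ × Q_{j_d}` containing `k`. -/
def crossLevel {d : ℕ} (k : Fin d → ℤ) : ℕ := ∑ s, dyadicLevel (k s)

theorem dyadicLevel_le_iff {n : ℤ} {j : ℕ} : dyadicLevel n ≤ j ↔ |n| ≤ 2 ^ j := by
  rw [dyadicLevel, Nat.clog_le_iff_le_pow one_lt_two, Int.abs_eq_natAbs]
  exact_mod_cast Iff.rfl

theorem abs_le_two_pow_dyadicLevel (n : ℤ) : |n| ≤ 2 ^ dyadicLevel n :=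
  dyadicLevel_le_iff.1 le_rfl

theorem dyadicLevel_zero : dyadicLevel 0 = 0 := by simp [dyadicLevel]

theorem mem_dyadicBlock {n : ℤ} {j : ℕ} : n ∈ dyadicBlock j ↔ dyadicLevel n = j := by
  unfold dyadicBlock
  rcases j with _ | j
  · have : dyadicLevel n = 0 ↔ |n| ≤ 1 := by
      rw [← Nat.le_zero, dyadicLevel_le_iff, pow_zero]
    rw [this, abs_le]
    simp
    omega
  · have h1 : dyadicLevel n = j + 1 ↔ |n| ≤ 2 ^ (j + 1) ∧ ¬ |n| ≤ 2 ^ j := by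
      rw [← dyadicLevel_le_iff, ← dyadicLevel_le_iff]; omega
    rw [h1]
    simp only [Nat.add_eq_zero_iff, one_ne_zero, and_false, if_false, Finset.mem_union,
      Finset.mem_Icc, Nat.add_sub_cancel]
    rw [abs_le, abs_le]
    have : (0 : ℤ) < 2 ^ j := by positivity
    have : (2 : ℤ) ^ (j + 1) = 2 * 2 ^ j := by ring
    omega

/-- The dyadic blocks partition `ℤ`, so `k` has just one index `j`; its level is a natural number,
so the real bound may be rounded down. -/
theorem mem_hyperbolicCross {d : ℕ} {R : ℝ} (hR : 0 ≤ R + d - 1) {k : Fin d → ℤ} :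
    k ∈ hyperbolicCross d R ↔ crossLevel k ≤ ⌊R + d - 1⌋₊ := by
  simp only [hyperbolicCross, Finset.mem_biUnion, mem_dyadicIndices, Fintype.mem_piFinset,
    mem_dyadicBlock]
  rw [Nat.le_floor_iff hR, crossLevel]
  push_cast
  constructor
  · rintro ⟨j, hj, hk⟩
    simpa only [hk] using hj
  · exact fun h => ⟨fun s => dyadicLevel (k s), h, fun _ => rfl⟩

theorem four_pow_dyadicLevel_le (n : ℤ) : (4 : ℝ) ^ dyadicLevel n ≤ 4 * (1 + (n : ℝ) ^ 2) := by
  rcases Nat.eq_zero_or_pos (dyadicLevel n) with h | h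
  · rw [h]; nlinarith [sq_nonneg (n : ℝ)]
  · obtain ⟨j, hj⟩ := Nat.exists_eq_add_of_lt h
    rw [zero_add] at hj
    have h1 : ¬ |n| ≤ 2 ^ j := by
      rw [← dyadicLevel_le_iff]; omega
    have h2 : (2 : ℝ) ^ j ≤ |(n : ℝ)| := by exact_mod_cast (not_le.1 h1).le
    rw [hj, pow_succ, show (4 : ℝ) = 2 ^ 2 by norm_num, ← pow_mul, mul_comm 2 j, pow_mul,
      ← sq_abs (n : ℝ)]
    have h3 : ((2 : ℝ) ^ j) ^ 2 ≤ |(n : ℝ)| ^ 2 := by gcongr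
    nlinarith

theorem one_add_sq_le (n : ℤ) : 1 + (n : ℝ) ^ 2 ≤ 2 * 4 ^ dyadicLevel n := by
  have h1 : |(n : ℝ)| ≤ 2 ^ dyadicLevel n := by exact_mod_cast abs_le_two_pow_dyadicLevel n
  have h2 : |(n : ℝ)| ^ 2 ≤ (2 ^ dyadicLevel n) ^ 2 := by gcongr
  rw [sq_abs, ← pow_mul, mul_comm, pow_mul] at h2
  norm_num at h2
  have h3 : (1 : ℝ) ≤ 4 ^ dyadicLevel n := one_le_pow₀ (by norm_num)
  linarith

theorem exists_le_sum_eq {ι : Type*} [Fintype ι] [DecidableEq ι] {T : ℕ} (j : ι → ℕ)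
    (h : T ≤ ∑ s, j s) : ∃ u : ι → ℕ, (∀ s, u s ≤ j s) ∧ ∑ s, u s = T := by
  obtain ⟨n, hn⟩ := Nat.exists_eq_add_of_le h
  induction n generalizing j with
  | zero => exact ⟨j, fun _ => le_rfl, hn⟩
  | succ n ih =>
    have : ∃ a ∈ Finset.univ, j a ≠ 0 := by
      apply Finset.exists_ne_zero_of_sum_ne_zero
      omega
    obtain ⟨a, -, ha⟩ := this
    have hs := Finset.sum_update_of_mem (Finset.mem_univ a) j (j a - 1)
    have hs' := Finset.add_sum_erase Finset.univ j (Finset.mem_univ a)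
    rw [Finset.sdiff_singleton_eq_erase] at hs
    obtain ⟨u, hu, hu'⟩ := ih (Function.update j a (j a - 1)) (by omega) (by omega)
    refine ⟨u, fun s => (hu s).trans ?_, hu'⟩
    by_cases h : s = a
    · subst h; simp
    · simp [h]

/-! ### Counting points of a dual coset in a dyadic block -/

/-- Choose `u ≤ j` with `‖u‖₁ = T` and cut the block into boxes with sides `2^{u_s}`. Each box holds
at most one point of `S`, and at most `∏ 3 · 2^{j_s - u_s}` boxes are needed. -/
theorem card_mul_two_pow_le {d : ℕ} {z : Fin d → ℤ} {M T : ℕ}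
    (hdual : ∀ h : Fin d → ℤ, crossLevel h ≤ T → (M : ℤ) ∣ ∑ s, h s * z s → h = 0)
    {j : Fin d → ℕ} (hj : T ≤ ∑ s, j s) (S : Finset (Fin d → ℤ))
    (hS : ∀ h ∈ S, ∀ s, dyadicLevel (h s) = j s)
    (hS' : ∀ h ∈ S, ∀ h' ∈ S, (M : ℤ) ∣ ∑ s, (h s - h' s) * z s) :
    S.card * 2 ^ T ≤ 3 ^ d * 2 ^ (∑ s, j s) := by
  obtain ⟨u, huj, hu⟩ := exists_le_sum_eq j hj
  have hcard : S.card ≤ (Fintype.piFinset fun s : Fin d =>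
      Finset.Icc (-2 ^ (j s - u s) : ℤ) (2 ^ (j s - u s))).card := by
    refine Finset.card_le_card_of_injOn (fun h s => h s / 2 ^ u s) ?_ ?_
    · intro h hh
      rw [Finset.mem_coe, Fintype.mem_piFinset]
      intro s
      rw [Finset.mem_Icc]
      have h1 := abs_le_two_pow_dyadicLevel (h s)
      rw [hS h hh s, ← Nat.sub_add_cancel (huj s), pow_add, abs_le] at h1
      have hp : (0 : ℤ) < 2 ^ u s := by positivity
      constructor
      · rw [Int.le_ediv_iff_mul_le hp]
        linarith [h1.1]
      · exact Int.ediv_le_of_le_mul hp h1.2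
    · intro h hh h' hh' heq
      -- Equal quotients force coordinate differences below `2^{u_s}`, so the difference is a dual
      -- vector of level at most `T`.
      have hz : h - h' = 0 := by
        refine hdual _ ?_ (hS' h hh h' hh')
        rw [← hu]
        refine Finset.sum_le_sum fun s _ => ?_
        rw [dyadicLevel_le_iff, Pi.sub_apply]
        have h1 : h s / 2 ^ u s = h' s / 2 ^ u s := congrFun heq s
        have hp : (0 : ℤ) < 2 ^ u s := by positivity
        have e1 := Int.mul_ediv_add_emod (h s) (2 ^ u s)
        have e2 := Int.mul_ediv_add_emod (h' s) (2 ^ u s)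
        have e3 := Int.emod_nonneg (h s) hp.ne'
        have e4 := Int.emod_nonneg (h' s) hp.ne'
        have e5 := Int.emod_lt_of_pos (h s) hp
        have e6 := Int.emod_lt_of_pos (h' s) hp
        rw [h1] at e1
        rw [abs_le]
        constructor <;> linarith
      exact sub_eq_zero.1 hz
  rw [Fintype.card_piFinset] at hcard
  calc S.card * 2 ^ T
      ≤ (∏ s : Fin d, (Finset.Icc (-2 ^ (j s - u s) : ℤ) (2 ^ (j s - u s))).card) * 2 ^ T := by
        gcongr
    _ = ∏ s : Fin d, (Finset.Icc (-2 ^ (j s - u s) : ℤ) (2 ^ (j s - u s))).card * 2 ^ u s := by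
        rw [Finset.prod_mul_distrib, Finset.prod_pow_eq_pow_sum, hu]
    _ ≤ ∏ s : Fin d, 3 * 2 ^ j s := by
        refine Finset.prod_le_prod' fun s _ => ?_
        have hc : (Finset.Icc (-2 ^ (j s - u s) : ℤ) (2 ^ (j s - u s))).card ≤
            3 * 2 ^ (j s - u s) := by
          rw [Int.card_Icc, Int.toNat_le]
          push_cast
          have : (1 : ℤ) ≤ 2 ^ (j s - u s) := one_le_pow₀ (by norm_num)
          linarith
        calc _ ≤ 3 * 2 ^ (j s - u s) * 2 ^ u s := by gcongr
          _ = 3 * 2 ^ j s := by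
            rw [mul_assoc, ← pow_add, Nat.sub_add_cancel (huj s)]
    _ = _ := by
        rw [Finset.prod_mul_distrib, Finset.prod_pow_eq_pow_sum]; simp

/-- The coset is sorted by dyadic blocks; on a block `g` is bounded by `G j`, and the number of
points is at most `3^d 2^{‖j‖₁ - T}`. -/
theorem tsum_lattice_coset_le {d : ℕ} {z : Fin d → ℤ} {M T : ℕ}
    (hdual : ∀ h : Fin d → ℤ, crossLevel h ≤ T → (M : ℤ) ∣ ∑ s, h s * z s → h = 0)
    (k : Fin d → ℤ) (p : (Fin d → ℤ) → Prop) [DecidablePred p]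
    (hp : ∀ h, p h → T < crossLevel h ∧ (M : ℤ) ∣ ∑ s, (h s - k s) * z s)
    (g : (Fin d → ℤ) → ℝ≥0∞) (G : (Fin d → ℕ) → ℝ≥0∞)
    (hg : ∀ h, g h ≤ G fun s => dyadicLevel (h s)) :
    2 ^ T * (∑' h, if p h then g h else 0) ≤
      3 ^ d * ∑' j : Fin d → ℕ, if T < ∑ s, j s then 2 ^ (∑ s, j s) * G j else 0 := by
  have h1 : (∑' h, if p h then g h else 0) ≤
      ∑' j : Fin d → ℕ, ∑' h, if p h ∧ (fun s => dyadicLevel (h s)) = j then G j else 0 := by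
    rw [ENNReal.tsum_comm]
    refine ENNReal.tsum_le_tsum fun h => ?_
    rw [tsum_eq_single (fun s => dyadicLevel (h s)) (fun j hj => if_neg fun hh => hj hh.2.symm)]
    by_cases hh : p h
    · simpa [hh] using hg h
    · simp [hh]
  refine (mul_le_mul_right h1 _).trans ?_
  rw [← ENNReal.tsum_mul_left, ← ENNReal.tsum_mul_left]
  refine ENNReal.tsum_le_tsum fun j => ?_
  let S := (Fintype.piFinset fun s => dyadicBlock (j s)).filter p
  have hS : ∀ h, h ∈ S ↔ p h ∧ (fun s => dyadicLevel (h s)) = j := by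
    intro h
    simp only [S, Finset.mem_filter, Fintype.mem_piFinset, mem_dyadicBlock, funext_iff]
    tauto
  have hsum : (∑' h, if p h ∧ (fun s => dyadicLevel (h s)) = j then G j else 0) = S.card * G j := by
    rw [tsum_eq_sum (s := S) (fun h hh => if_neg fun h' => hh ((hS h).2 h'))]
    rw [Finset.sum_congr rfl (fun h hh => if_pos ((hS h).1 hh)), Finset.sum_const, nsmul_eq_mul]
  rw [hsum]
  by_cases hj : T < ∑ s, j s
  · rw [if_pos hj, ← mul_assoc, ← mul_assoc]
    refine mul_le_mul_left ?_ _
    have := card_mul_two_pow_le hdual hj.le S (fun h hh s => congrFun ((hS h).1 hh).2 s) ?_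
    · rw [mul_comm]; exact_mod_cast this
    · intro h hh h' hh'
      have e := dvd_sub (hp h ((hS h).1 hh).1).2 (hp h' ((hS h').1 hh').1).2
      rw [← Finset.sum_sub_distrib] at e
      refine e.trans (dvd_of_eq (Finset.sum_congr rfl fun s _ => ?_))
      ring
  · have : S = ∅ := by
      refine Finset.eq_empty_of_forall_notMem fun h hh => hj ?_
      obtain ⟨e1, e2⟩ := (hS h).1 hh
      rw [← e2]
      exact (hp h e1).1
    simp [this]

/-! ### Series over dyadic indices -/

theorem ENNReal.tsum_prod_pi {ι : Type*} {d : ℕ} (f : Fin d → ι → ℝ≥0∞) :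
    ∑' v : Fin d → ι, ∏ s, f s (v s) = ∏ s, ∑' n, f s n := by
  induction d with
  | zero => simp
  | succ d ih =>
    rw [← (Fin.consEquiv fun _ : Fin (d + 1) => ι).tsum_eq, ENNReal.tsum_prod']
    simp only [Fin.prod_univ_succ, Fin.consEquiv_apply, Fin.cons_zero, Fin.cons_succ]
    simp_rw [ENNReal.tsum_mul_left, ih fun s => f s.succ, ENNReal.tsum_mul_right]

theorem ENNReal.tsum_geometric_tail_le (x : ℝ≥0∞) (T : ℕ) :
    (∑' n : ℕ, if T < n then x ^ n else 0) ≤ x ^ T * (1 - x)⁻¹ := by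
  rw [← ENNReal.summable.sum_add_tsum_nat_add' (k := T), Finset.sum_eq_zero, zero_add,
    ← ENNReal.tsum_geometric, ← ENNReal.tsum_mul_left]
  · refine ENNReal.tsum_le_tsum fun n => ?_
    rw [← pow_add, add_comm T n]
    split_ifs <;> simp
  · intro n hn
    rw [if_neg]
    have := Finset.mem_range.1 hn
    omega

/-- Replacing the coordinate `j s` by the total `‖j‖₁` is injective. In the new variables the
summand is a product, and summing over all of them leaves a geometric tail times `d - 1` full
geometric series. -/
theorem tsum_dyadic_tail_le {d : ℕ} (s : Fin d) (x y : ℝ≥0∞) (T : ℕ) :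
    (∑' j : Fin d → ℕ, if T < ∑ t, j t then
      x ^ (∑ t, j t) * ∏ t ∈ Finset.univ.erase s, y ^ j t else 0) ≤
      x ^ T * (1 - x)⁻¹ * ((1 - y)⁻¹) ^ (d - 1) := by
  let f : Fin d → ℕ → ℝ≥0∞ := fun t n =>
    if t = s then (if T < n then x ^ n else 0) else y ^ n
  let Φ : (Fin d → ℕ) → (Fin d → ℕ) := fun j => Function.update j s (∑ t, j t)
  have hΦ : Function.Injective Φ := by
    intro j j' h
    have h1 : ∀ t, t ≠ s → j t = j' t := fun t ht => by
      simpa [Φ, ht] using congrFun h t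
    have h2 : ∑ t, j t = ∑ t, j' t := by simpa [Φ] using congrFun h s
    rw [← Finset.add_sum_erase Finset.univ j (Finset.mem_univ s),
      ← Finset.add_sum_erase Finset.univ j' (Finset.mem_univ s),
      Finset.sum_congr rfl fun t ht => h1 t (Finset.ne_of_mem_erase ht)] at h2
    ext t
    by_cases ht : t = s
    · rw [ht]; exact Nat.add_right_cancel h2
    · exact h1 t ht
  have hf : ∀ v : Fin d → ℕ, ∏ t, f t (v t) =
      (if T < v s then x ^ v s else 0) * ∏ t ∈ Finset.univ.erase s, y ^ v t := by
    intro v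
    rw [← Finset.mul_prod_erase Finset.univ _ (Finset.mem_univ s)]
    congr 1
    · simp [f]
    · exact Finset.prod_congr rfl fun t ht => by simp [f, Finset.ne_of_mem_erase ht]
  calc _ = ∑' j, (fun v : Fin d → ℕ => ∏ t, f t (v t)) (Φ j) := by
        refine tsum_congr fun j => ?_
        simp only [hf]
        have e : ∏ t ∈ Finset.univ.erase s, y ^ Φ j t = ∏ t ∈ Finset.univ.erase s, y ^ j t :=
          Finset.prod_congr rfl fun t ht => by simp [Φ, Finset.ne_of_mem_erase ht]
        rw [e]
        simp only [Φ, Function.update_self]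
        split_ifs <;> simp
    _ ≤ ∑' v : Fin d → ℕ, ∏ t, f t (v t) := ENNReal.tsum_comp_le_tsum_of_injective hΦ _
    _ = ∏ t, ∑' n, f t n := ENNReal.tsum_prod_pi f
    _ = (∑' n, if T < n then x ^ n else 0) * ∏ t ∈ Finset.univ.erase s, (1 - y)⁻¹ := by
        rw [← Finset.mul_prod_erase Finset.univ _ (Finset.mem_univ s)]
        congr 1
        · simp [f]
        · refine Finset.prod_congr rfl fun t ht => ?_
          rw [← ENNReal.tsum_geometric]
          simp [f, Finset.ne_of_mem_erase ht]
    _ ≤ _ := by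
        rw [Finset.prod_const, Finset.card_erase_of_mem (Finset.mem_univ s), Finset.card_univ,
          Fintype.card_fin]
        exact mul_le_mul_left (ENNReal.tsum_geometric_tail_le x T) _

/-! ### Weight estimates -/

theorem one_add_sq_pos (n : ℤ) : 0 < 1 + (n : ℝ) ^ 2 := by positivity

theorem one_add_sq_rpow_le {r : ℝ} (hr : 0 ≤ r) (n : ℤ) :
    (1 + (n : ℝ) ^ 2) ^ r ≤ 2 ^ r * ((4 : ℝ) ^ r) ^ dyadicLevel n := by
  calc (1 + (n : ℝ) ^ 2) ^ r ≤ (2 * 4 ^ dyadicLevel n) ^ r :=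
        Real.rpow_le_rpow (one_add_sq_pos n).le (one_add_sq_le n) hr
    _ = _ := by
        rw [Real.mul_rpow (by norm_num) (by positivity), ← Real.rpow_natCast, ← Real.rpow_natCast,
          ← Real.rpow_mul (by norm_num), ← Real.rpow_mul (by norm_num), mul_comm r]

theorem one_add_sq_rpow_neg_le {r : ℝ} (hr : 0 ≤ r) (n : ℤ) :
    (1 + (n : ℝ) ^ 2) ^ (-r) ≤ 4 ^ r * ((4 : ℝ) ^ (-r)) ^ dyadicLevel n := by
  have h : (4 : ℝ) ^ ((dyadicLevel n : ℝ) - 1) ≤ 1 + (n : ℝ) ^ 2 := by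
    rw [Real.rpow_sub_one (by norm_num), Real.rpow_natCast, div_le_iff₀ (by norm_num)]
    linarith [four_pow_dyadicLevel_le n]
  calc (1 + (n : ℝ) ^ 2) ^ (-r) ≤ ((4 : ℝ) ^ ((dyadicLevel n : ℝ) - 1)) ^ (-r) :=
        Real.rpow_le_rpow_of_nonpos (by positivity) h (by linarith)
    _ = _ := by
        rw [← Real.rpow_natCast, ← Real.rpow_mul (by norm_num), ← Real.rpow_mul (by norm_num),
          ← Real.rpow_add (by norm_num)]
        congr 1; ring

theorem prod_one_add_sq_rpow_le {d : ℕ} {r : ℝ} (hr : 0 ≤ r) (k : Fin d → ℤ) :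
    ∏ s, (1 + (k s : ℝ) ^ 2) ^ r ≤ (2 ^ r) ^ d * ((4 : ℝ) ^ r) ^ crossLevel k := by
  calc ∏ s, (1 + (k s : ℝ) ^ 2) ^ r ≤ ∏ s, 2 ^ r * ((4 : ℝ) ^ r) ^ dyadicLevel (k s) :=
        Finset.prod_le_prod (fun s _ => by positivity) fun s _ => one_add_sq_rpow_le hr _
    _ = _ := by
        rw [Finset.prod_mul_distrib, Finset.prod_pow_eq_pow_sum, crossLevel]; simp

theorem prod_one_add_sq_rpow_neg_le {d : ℕ} {r : ℝ} (hr : 0 ≤ r) (k : Fin d → ℤ) :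
    ∏ s, (1 + (k s : ℝ) ^ 2) ^ (-r) ≤ (4 ^ r) ^ d * ((4 : ℝ) ^ (-r)) ^ crossLevel k := by
  calc ∏ s, (1 + (k s : ℝ) ^ 2) ^ (-r) ≤ ∏ s, 4 ^ r * ((4 : ℝ) ^ (-r)) ^ dyadicLevel (k s) :=
        Finset.prod_le_prod (fun s _ => by positivity) fun s _ => one_add_sq_rpow_neg_le hr _
    _ = _ := by
        rw [Finset.prod_mul_distrib, Finset.prod_pow_eq_pow_sum, crossLevel]; simp

theorem one_add_sum_le_prod {ι : Type*} (S : Finset ι) (a : ι → ℝ) (ha : ∀ i, 0 ≤ a i) :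
    1 + ∑ i ∈ S, a i ≤ ∏ i ∈ S, (1 + a i) := by
  classical
  induction S using Finset.induction_on with
  | empty => simp
  | insert i S hi ih =>
    rw [Finset.sum_insert hi, Finset.prod_insert hi]
    have : 0 ≤ ∑ i ∈ S, a i := Finset.sum_nonneg fun i _ => ha i
    nlinarith [ha i, mul_nonneg (ha i) this, mul_le_mul_of_nonneg_left ih (ha i)]

/-- Since `1 + ‖k‖₂² ≤ ∏ (1 + k_s²)` and `β ≤ 0`, the isotropic factor costs at most the exponent
`β` in every coordinate. -/
theorem prod_rpow_le_sobolevWeight {d : ℕ} {α β : ℝ} (hβ : β ≤ 0) (k : Fin d → ℤ) :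
    ∏ s, (1 + (k s : ℝ) ^ 2) ^ (α + β) ≤ sobolevWeight α β k := by
  have h0 : 0 ≤ ∑ s, (k s : ℝ) ^ 2 := Finset.sum_nonneg fun _ _ => sq_nonneg _
  have h1 : (∏ s, (1 + (k s : ℝ) ^ 2)) ^ β ≤ (1 + ∑ s, (k s : ℝ) ^ 2) ^ β :=
    Real.rpow_le_rpow_of_nonpos (by linarith)
      (one_add_sum_le_prod _ _ fun s => sq_nonneg (k s : ℝ)) hβ
  rw [← Real.finsetProd_rpow _ _ fun s _ => (one_add_sq_pos (k s)).le] at h1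
  calc _ = (∏ s, (1 + (k s : ℝ) ^ 2) ^ β) * ∏ s, (1 + (k s : ℝ) ^ 2) ^ α := by
        rw [← Finset.prod_mul_distrib]
        refine Finset.prod_congr rfl fun s _ => ?_
        rw [← Real.rpow_add (one_add_sq_pos _), add_comm β]
    _ ≤ _ := mul_le_mul_of_nonneg_right h1 (Finset.prod_nonneg fun s _ => by positivity)

theorem sobolevWeight_zero_right {d : ℕ} (γ : ℝ) (k : Fin d → ℤ) :
    sobolevWeight γ 0 k = ∏ s, (1 + (k s : ℝ) ^ 2) ^ γ := by
  simp [sobolevWeight]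

theorem sobolevWeight_mixed_le {d : ℕ} {α β γ : ℝ} (hβ : β ≤ 0) (hγ : γ ≤ α + β) (k : Fin d → ℤ) :
    sobolevWeight γ 0 k ≤ (4 ^ (α + β - γ)) ^ d * ((4 : ℝ) ^ (-(α + β - γ))) ^ crossLevel k *
      sobolevWeight α β k := by
  rw [sobolevWeight_zero_right]
  calc _ = (∏ s, (1 + (k s : ℝ) ^ 2) ^ (-(α + β - γ))) * ∏ s, (1 + (k s : ℝ) ^ 2) ^ (α + β) := by
        rw [← Finset.prod_mul_distrib]
        refine Finset.prod_congr rfl fun s _ => ?_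
        rw [← Real.rpow_add (one_add_sq_pos _)]
        congr 1; ring
    _ ≤ _ := mul_le_mul (prod_one_add_sq_rpow_neg_le (by linarith) k)
        (prod_rpow_le_sobolevWeight hβ k) (Finset.prod_nonneg fun s _ => by positivity)
        (by positivity)

/-- If `s` has the largest level, the isotropic factor is at most a constant times `2^{q j_s}`, and
`2^{q j_s}` equals `2^{q‖j‖₁}` times the decay `2^{-q j_t}` in all other coordinates. Summing over
`s` removes the dependence on the maximal coordinate. -/
theorem inv_sobolevWeight_le {d : ℕ} (hd : 0 < d) {α β q : ℝ} (hα : 0 ≤ α) (hβ : β ≤ 0)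
    (hq : -2 * β ≤ q) (k : Fin d → ℤ) :
    (sobolevWeight α β k)⁻¹ ≤ (2 * d) ^ (-β) * (4 ^ α) ^ d *
      ∑ s, ((2 : ℝ) ^ (-(2 * α - q))) ^ crossLevel k *
        ∏ t ∈ Finset.univ.erase s, ((2 : ℝ) ^ (-q)) ^ dyadicLevel (k t) := by
  have : Nonempty (Fin d) := ⟨⟨0, hd⟩⟩
  obtain ⟨s, -, hs⟩ := Finset.exists_max_image Finset.univ (fun t => dyadicLevel (k t))
    Finset.univ_nonempty
  have h1 : 1 + ∑ t, (k t : ℝ) ^ 2 ≤ 2 * d * 4 ^ dyadicLevel (k s) := by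
    calc 1 + ∑ t, (k t : ℝ) ^ 2 ≤ ∑ t : Fin d, (1 + (k t : ℝ) ^ 2) := by
          rw [Finset.sum_add_distrib]
          have : (1 : ℝ) ≤ d := by exact_mod_cast hd
          simpa using this
      _ ≤ ∑ t : Fin d, 2 * (4 : ℝ) ^ dyadicLevel (k s) := by
          refine Finset.sum_le_sum fun t _ => (one_add_sq_le _).trans ?_
          have := hs t (Finset.mem_univ t)
          gcongr
          norm_num
      _ = _ := by simp; ring
  have hpos : 0 < 1 + ∑ t, (k t : ℝ) ^ 2 := by
    have : 0 ≤ ∑ s, (k s : ℝ) ^ 2 := Finset.sum_nonneg fun _ _ => sq_nonneg _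
    linarith
  have h2 : (1 + ∑ t, (k t : ℝ) ^ 2) ^ (-β) ≤ (2 * d) ^ (-β) * ((2 : ℝ) ^ q) ^ dyadicLevel (k s) := by
    calc (1 + ∑ t, (k t : ℝ) ^ 2) ^ (-β) ≤ (2 * d * 4 ^ dyadicLevel (k s)) ^ (-β) :=
          Real.rpow_le_rpow hpos.le h1 (by linarith)
      _ = (2 * d) ^ (-β) * ((2 : ℝ) ^ (-2 * β)) ^ dyadicLevel (k s) := by
          rw [Real.mul_rpow (by positivity) (by positivity)]
          congr 1
          rw [show (4 : ℝ) = 2 ^ (2 : ℝ) by norm_num, ← Real.rpow_natCast, ← Real.rpow_natCast,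
            ← Real.rpow_mul (by norm_num), ← Real.rpow_mul (by norm_num),
            ← Real.rpow_mul (by norm_num)]
          congr 1; ring
      _ ≤ _ := by
          gcongr
          norm_num
  have h3 := prod_one_add_sq_rpow_neg_le hα k
  have h4 : (sobolevWeight α β k)⁻¹ =
      (1 + ∑ t, (k t : ℝ) ^ 2) ^ (-β) * ∏ s, (1 + (k s : ℝ) ^ 2) ^ (-α) := by
    rw [sobolevWeight, mul_inv, Real.rpow_neg hpos.le, ← Finset.prod_inv_distrib]
    congr 1
    exact Finset.prod_congr rfl fun s _ => (Real.rpow_neg (one_add_sq_pos _).le _).symm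
  rw [h4]
  refine (mul_le_mul h2 h3 (Finset.prod_nonneg fun s _ => by positivity) (by positivity)).trans ?_
  have h5 : ((2 : ℝ) ^ q) ^ dyadicLevel (k s) * ((4 : ℝ) ^ (-α)) ^ crossLevel k =
      ((2 : ℝ) ^ (-(2 * α - q))) ^ crossLevel k *
        ∏ t ∈ Finset.univ.erase s, ((2 : ℝ) ^ (-q)) ^ dyadicLevel (k t) := by
    have hc : crossLevel k = dyadicLevel (k s) + ∑ t ∈ Finset.univ.erase s, dyadicLevel (k t) :=
      (Finset.add_sum_erase Finset.univ _ (Finset.mem_univ s)).symm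
    rw [Finset.prod_pow_eq_pow_sum, hc]
    rw [show (4 : ℝ) = 2 ^ (2 : ℝ) by norm_num]
    simp only [← Real.rpow_natCast, ← Real.rpow_mul (show (0 : ℝ) ≤ 2 by norm_num),
            ← Real.rpow_add (show (0 : ℝ) < 2 by norm_num)]
    congr 1; push_cast; ring
  calc _ = (2 * d) ^ (-β) * (4 ^ α) ^ d *
        (((2 : ℝ) ^ q) ^ dyadicLevel (k s) * ((4 : ℝ) ^ (-α)) ^ crossLevel k) := by ring
    _ ≤ _ := by
        rw [h5]
        refine mul_le_mul_of_nonneg_left ?_ (by positivity)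
        exact Finset.single_le_sum (f := fun s => ((2 : ℝ) ^ (-(2 * α - q))) ^ crossLevel k *
          ∏ t ∈ Finset.univ.erase s, ((2 : ℝ) ^ (-q)) ^ dyadicLevel (k t))
          (fun t _ => mul_nonneg (by positivity) (Finset.prod_nonneg fun _ _ => by positivity))
          (Finset.mem_univ s)

theorem summable_one_add_sq_rpow {r : ℝ} (hr : 1 / 2 < r) :
    Summable fun n : ℤ => (1 + (n : ℝ) ^ 2) ^ (-r) := by
  refine (Real.summable_abs_int_rpow (b := 2 * r) (by linarith)).of_norm_bounded_eventually ?_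
  have : ∀ᶠ n : ℤ in Filter.cofinite, n ≠ 0 := by
    simpa using (Set.finite_singleton (0 : ℤ)).compl_mem_cofinite
  filter_upwards [this] with n hn
  have hn' : 0 < |(n : ℝ)| := by positivity
  rw [Real.norm_of_nonneg (by positivity), show -(2 * r) = 2 * -r by ring,
    Real.rpow_mul hn'.le, Real.rpow_two, sq_abs]
  exact Real.rpow_le_rpow_of_nonpos (by positivity) (by linarith) (by linarith)

theorem tsum_inv_sobolevWeight_ne_top {d : ℕ} {α β : ℝ} (hβ : β ≤ 0) (h : 1 / 2 < α + β) :
    ∑' k : Fin d → ℤ, (ENNReal.ofReal (sobolevWeight α β k))⁻¹ ≠ ∞ := by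
  have h1 : ∀ k : Fin d → ℤ, (ENNReal.ofReal (sobolevWeight α β k))⁻¹ ≤
      ∏ s, ENNReal.ofReal ((1 + (k s : ℝ) ^ 2) ^ (-(α + β))) := by
    intro k
    rw [← ENNReal.ofReal_inv_of_pos (sobolevWeight_pos α β k),
      ← ENNReal.ofReal_prod_of_nonneg fun s _ => by positivity]
    refine ENNReal.ofReal_le_ofReal ?_
    rw [Finset.prod_congr rfl fun s _ => Real.rpow_neg (one_add_sq_pos (k s)).le _,
      Finset.prod_inv_distrib]
    exact inv_anti₀ (Finset.prod_pos fun s _ => Real.rpow_pos_of_pos (one_add_sq_pos _) _)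
      (prod_rpow_le_sobolevWeight hβ k)
  refine ne_top_of_le_ne_top ?_ (ENNReal.tsum_le_tsum h1)
  rw [ENNReal.tsum_prod_pi (fun _ (n : ℤ) => ENNReal.ofReal ((1 + (n : ℝ) ^ 2) ^ (-(α + β))))]
  refine ENNReal.prod_ne_top fun _ _ => ?_
  exact (summable_one_add_sq_rpow h).tsum_ofReal_ne_top

/-! ### Inverse weights summed over a coset -/

theorem ENNReal.inv_one_sub_ofReal {x : ℝ} (hx0 : 0 ≤ x) (hx : x < 1) :
    (1 - ENNReal.ofReal x)⁻¹ = ENNReal.ofReal (1 - x)⁻¹ := by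
  rw [ENNReal.ofReal_inv_of_pos (by linarith), ENNReal.ofReal_sub _ hx0, ENNReal.ofReal_one]

theorem tsum_coset_inv_sobolevWeight_le {d : ℕ} (hd : 0 < d) {α β q : ℝ} (hα : 0 ≤ α) (hβ : β ≤ 0)
    (hq : -2 * β ≤ q) (hq0 : 0 < q) (hqα : q < 2 * α - 1)
    {z : Fin d → ℤ} {M T : ℕ}
    (hdual : ∀ h : Fin d → ℤ, crossLevel h ≤ T → (M : ℤ) ∣ ∑ s, h s * z s → h = 0)
    (k : Fin d → ℤ) (p : (Fin d → ℤ) → Prop) [DecidablePred p]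
    (hp : ∀ h, p h → T < crossLevel h ∧ (M : ℤ) ∣ ∑ s, (h s - k s) * z s) :
    (∑' h, if p h then (ENNReal.ofReal (sobolevWeight α β h))⁻¹ else 0) ≤
      ENNReal.ofReal (3 ^ d * ((2 * d) ^ (-β) * (4 ^ α) ^ d) * d *
        ((2 : ℝ) ^ (-(2 * α - q))) ^ T * (1 - (2 : ℝ) ^ (-(2 * α - 1 - q)))⁻¹ *
          ((1 - (2 : ℝ) ^ (-q))⁻¹) ^ (d - 1)) := by
  set K : ℝ := (2 * d) ^ (-β) * (4 ^ α) ^ d with hK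
  have hK0 : 0 ≤ K := by positivity
  set x : ℝ := (2 : ℝ) ^ (-(2 * α - q)) with hx
  set x' : ℝ := (2 : ℝ) ^ (-(2 * α - 1 - q)) with hx'
  set y : ℝ := (2 : ℝ) ^ (-q) with hy
  have hx0 : 0 ≤ x := by positivity
  have hx'0 : 0 ≤ x' := by positivity
  have hy0 : 0 ≤ y := by positivity
  -- The factor `2^{‖j‖₁}` from counting turns the ratio `x` into `x'`; `q < 2α - 1` keeps it below
  -- 1.
  have hxx' : 2 * x = x' := by
    rw [hx, hx', show -(2 * α - 1 - q) = -(2 * α - q) + 1 by ring, Real.rpow_add_one (by norm_num)]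
    ring
  have hx'1 : x' < 1 := Real.rpow_lt_one_of_one_lt_of_neg (by norm_num) (by linarith)
  have hy1 : y < 1 := Real.rpow_lt_one_of_one_lt_of_neg (by norm_num) (by linarith)
  let G : (Fin d → ℕ) → ℝ≥0∞ := fun j => ENNReal.ofReal K * ∑ s,
    ENNReal.ofReal x ^ (∑ t, j t) * ∏ t ∈ Finset.univ.erase s, ENNReal.ofReal y ^ j t
  have hG : ∀ h : Fin d → ℤ, (ENNReal.ofReal (sobolevWeight α β h))⁻¹ ≤
      G fun s => dyadicLevel (h s) := by
    intro h
    rw [← ENNReal.ofReal_inv_of_pos (sobolevWeight_pos α β h)]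
    refine (ENNReal.ofReal_le_ofReal (inv_sobolevWeight_le hd hα hβ hq h)).trans (le_of_eq ?_)
    rw [ENNReal.ofReal_mul hK0, ENNReal.ofReal_sum_of_nonneg fun s _ =>
      mul_nonneg (by positivity) (Finset.prod_nonneg fun _ _ => by positivity)]
    simp only [G]
    congr 1
    refine Finset.sum_congr rfl fun s _ => ?_
    rw [ENNReal.ofReal_mul (by positivity), ENNReal.ofReal_prod_of_nonneg fun _ _ => by positivity,
      ENNReal.ofReal_pow hx0]
    congr 1
    exact Finset.prod_congr rfl fun t _ => ENNReal.ofReal_pow hy0 _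
  have hsum : (∑' j : Fin d → ℕ, if T < ∑ s, j s then 2 ^ (∑ s, j s) * G j else 0) ≤
      ENNReal.ofReal K * (d * (ENNReal.ofReal x' ^ T * (1 - ENNReal.ofReal x')⁻¹ *
        ((1 - ENNReal.ofReal y)⁻¹) ^ (d - 1))) := by
    have e : ∀ j : Fin d → ℕ, (if T < ∑ s, j s then 2 ^ (∑ s, j s) * G j else 0) =
        ENNReal.ofReal K * ∑ s, if T < ∑ t, j t then
          ENNReal.ofReal x' ^ (∑ t, j t) * ∏ t ∈ Finset.univ.erase s, ENNReal.ofReal y ^ j t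
          else 0 := by
      intro j
      split_ifs
      · simp only [G]
        rw [mul_left_comm, Finset.mul_sum]
        congr 1
        refine Finset.sum_congr rfl fun s _ => ?_
        rw [← mul_assoc, ← mul_pow, ← hxx', ENNReal.ofReal_mul (by norm_num)]
        norm_num
      · simp
    simp_rw [e]
    rw [ENNReal.tsum_mul_left, Summable.tsum_finsetSum fun _ _ => ENNReal.summable]
    refine mul_le_mul_right ((Finset.sum_le_sum fun s _ =>
      tsum_dyadic_tail_le s (ENNReal.ofReal x') (ENNReal.ofReal y) T).trans (le_of_eq ?_)) _
    simp
  have hmain := (tsum_lattice_coset_le hdual k p hp _ G hG).trans (mul_le_mul_right hsum _)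
  set S := ∑' h, if p h then (ENNReal.ofReal (sobolevWeight α β h))⁻¹ else 0
  -- Dividing by the `2^T` of the counting bound turns `x'^T` back into `x^T`.
  have h2T : (2 : ℝ≥0∞) ^ T * (2⁻¹) ^ T = 1 := by
    rw [← mul_pow, ENNReal.mul_inv_cancel (by norm_num) (by norm_num), one_pow]
  have hS : S = 2⁻¹ ^ T * (2 ^ T * S) := by
    rw [← mul_assoc, mul_comm (2⁻¹ ^ T), h2T, one_mul]
  have h1x : 0 ≤ (1 - x')⁻¹ := inv_nonneg.2 (by linarith)
  have h1y : 0 ≤ (1 - y)⁻¹ := inv_nonneg.2 (by linarith)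
  rw [hS]
  refine (mul_le_mul_right hmain _).trans (le_of_eq ?_)
  rw [ENNReal.inv_one_sub_ofReal hx'0 hx'1, ENNReal.inv_one_sub_ofReal hy0 hy1]
  have h3 : (3 : ℝ≥0∞) = ENNReal.ofReal 3 := by norm_num
  have h2 : (2⁻¹ : ℝ≥0∞) = ENNReal.ofReal 2⁻¹ := by
    rw [ENNReal.ofReal_inv_of_pos (by norm_num)]; norm_num
  have hdd : (d : ℝ≥0∞) = ENNReal.ofReal d := by simp
  rw [h3, h2, hdd, ← ENNReal.ofReal_pow h1y, ← ENNReal.ofReal_pow hx'0,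
    ← ENNReal.ofReal_pow (by norm_num), ← ENNReal.ofReal_pow (by norm_num),
    ← ENNReal.ofReal_mul (by positivity), ← ENNReal.ofReal_mul (by positivity),
    ← ENNReal.ofReal_mul (by positivity), ← ENNReal.ofReal_mul (by positivity),
    ← ENNReal.ofReal_mul (by positivity), ← ENNReal.ofReal_mul (by positivity)]
  congr 1
  rw [← hxx', mul_pow]
  have : (2⁻¹ : ℝ) ^ T * 2 ^ T = 1 := by rw [← mul_pow]; norm_num
  linear_combination (3 ^ d * K * d * x ^ T * (1 - 2 * x)⁻¹ * (1 - y)⁻¹ ^ (d - 1)) * this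

/-- The extra factor `T^{d-1}` of the squared aliasing error in the case `β = 0`. -/
def logFactor (d : ℕ) (β : ℝ) (T : ℕ) : ℝ := if β = 0 then (T : ℝ) ^ (d - 1) else 1

/-- Bernoulli's inequality for `(1 - 1/2)^q`. -/
theorem half_le_one_sub_two_rpow_neg {q : ℝ} (hq0 : 0 ≤ q) (hq1 : q ≤ 1) :
    q / 2 ≤ 1 - (2 : ℝ) ^ (-q) := by
  have := rpow_one_add_le_one_add_mul_self (s := -(1 / 2 : ℝ)) (by norm_num) hq0 hq1
  rw [show (1 : ℝ) + -(1 / 2) = 2⁻¹ by norm_num, Real.inv_rpow (by norm_num),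
    ← Real.rpow_neg (by norm_num)] at this
  linarith

/-- For `β < 0` take `q = -2β`, which is positive and independent of `T`. For `β = 0` the optimal `q
= 0` is excluded; `q = ε/T` loses only `2^ε` in the main factor, while the `d - 1` geometric series
cost `O(T)` each. -/
theorem exists_exponent_bound {d : ℕ} {α β : ℝ} (hβ : β ≤ 0) (hαβ : 1 / 2 < α + β) :
    ∃ C : ℝ, 0 ≤ C ∧ ∀ T : ℕ, 1 ≤ T → ∃ q : ℝ, -2 * β ≤ q ∧ 0 < q ∧ q < 2 * α - 1 ∧
      ((2 : ℝ) ^ (-(2 * α - q))) ^ T * (1 - (2 : ℝ) ^ (-(2 * α - 1 - q)))⁻¹ *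
          ((1 - (2 : ℝ) ^ (-q))⁻¹) ^ (d - 1) ≤
        C * ((4 : ℝ) ^ (-(α + β))) ^ T * logFactor d β T := by
  have h42 : (4 : ℝ) ^ (-(α + β)) = (2 : ℝ) ^ (-(2 * α + 2 * β)) := by
    rw [show (4 : ℝ) = 2 ^ (2 : ℝ) by norm_num, ← Real.rpow_mul (by norm_num)]
    congr 1; ring
  rcases hβ.lt_or_eq with hβ' | rfl
  · have hy1 : (2 : ℝ) ^ (-(-2 * β)) < 1 :=
      Real.rpow_lt_one_of_one_lt_of_neg (by norm_num) (by linarith)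
    have hx1 : (2 : ℝ) ^ (-(2 * α - 1 - -2 * β)) < 1 :=
      Real.rpow_lt_one_of_one_lt_of_neg (by norm_num) (by linarith)
    refine ⟨(1 - (2 : ℝ) ^ (-(2 * α - 1 - -2 * β)))⁻¹ * ((1 - (2 : ℝ) ^ (-(-2 * β)))⁻¹) ^ (d - 1),
      mul_nonneg (inv_nonneg.2 (by linarith)) (pow_nonneg (inv_nonneg.2 (by linarith)) _),
      fun T _ => ⟨-2 * β, le_rfl, by linarith, by linarith, le_of_eq ?_⟩⟩
    rw [logFactor, if_neg hβ'.ne, h42, show 2 * α - -2 * β = 2 * α + 2 * β by ring]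
    ring
  · rw [add_zero] at hαβ
    -- The bound 1 permits Bernoulli's inequality; the other bound keeps `2α - 1 - q` at least `(2α
    -- - 1)/2`.
    set ε : ℝ := min 1 ((2 * α - 1) / 2) with hε
    have hε0 : 0 < ε := lt_min one_pos (by linarith)
    have hε1 : ε ≤ 1 := min_le_left _ _
    have hε2 : ε ≤ (2 * α - 1) / 2 := min_le_right _ _
    have hx1 : (2 : ℝ) ^ (-((2 * α - 1) / 2)) < 1 :=
      Real.rpow_lt_one_of_one_lt_of_neg (by norm_num) (by linarith)
    have hx1' : 0 ≤ (1 - (2 : ℝ) ^ (-((2 * α - 1) / 2)))⁻¹ := inv_nonneg.2 (by linarith)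
    refine ⟨2 ^ ε * (1 - (2 : ℝ) ^ (-((2 * α - 1) / 2)))⁻¹ * (2 / ε) ^ (d - 1),
      mul_nonneg (mul_nonneg (by positivity) hx1') (by positivity), fun T hT => ?_⟩
    have hT' : (1 : ℝ) ≤ T := by exact_mod_cast hT
    have hqε : ε / T ≤ ε := div_le_self hε0.le hT'
    have hq0 : 0 < ε / T := by positivity
    refine ⟨ε / T, by simpa using hq0.le, hq0, by linarith, ?_⟩
    rw [logFactor, if_pos rfl, h42]
    have e1 : ((2 : ℝ) ^ (-(2 * α - ε / T))) ^ T = 2 ^ ε * ((2 : ℝ) ^ (-(2 * α + 2 * 0))) ^ T := by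
      rw [← Real.rpow_natCast, ← Real.rpow_natCast, ← Real.rpow_mul (by norm_num),
        ← Real.rpow_mul (by norm_num), ← Real.rpow_add (by norm_num)]
      congr 1
      field_simp
      ring
    have e2 : (1 - (2 : ℝ) ^ (-(2 * α - 1 - ε / T)))⁻¹ ≤
        (1 - (2 : ℝ) ^ (-((2 * α - 1) / 2)))⁻¹ := by
      refine inv_anti₀ (by linarith) (sub_le_sub_left ?_ _)
      exact Real.rpow_le_rpow_of_exponent_le (by norm_num) (by linarith)
    have e3 : (1 - (2 : ℝ) ^ (-(ε / T)))⁻¹ ≤ 2 / ε * T := by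
      have h := half_le_one_sub_two_rpow_neg hq0.le (hqε.trans hε1)
      calc _ ≤ (ε / T / 2)⁻¹ := inv_anti₀ (by positivity) h
        _ = _ := by field_simp
    have e4 : 0 ≤ (1 - (2 : ℝ) ^ (-(ε / T)))⁻¹ := by
      have h := half_le_one_sub_two_rpow_neg hq0.le (hqε.trans hε1)
      exact inv_nonneg.2 (le_trans (by positivity) h)
    have e5 : ((1 - (2 : ℝ) ^ (-(ε / T)))⁻¹) ^ (d - 1) ≤ (2 / ε * T) ^ (d - 1) :=
      pow_le_pow_left₀ e4 e3 _
    rw [mul_pow] at e5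
    calc _ ≤ 2 ^ ε * ((2 : ℝ) ^ (-(2 * α + 2 * 0))) ^ T *
          (1 - (2 : ℝ) ^ (-((2 * α - 1) / 2)))⁻¹ * ((2 / ε) ^ (d - 1) * (T : ℝ) ^ (d - 1)) := by
          rw [e1]
          exact mul_le_mul (mul_le_mul_of_nonneg_left e2 (by positivity)) e5 (by positivity)
            (mul_nonneg (by positivity) hx1')
      _ = _ := by ring

/-! ### Upper bound for the operator norm -/

theorem zero_mem_hyperbolicCross {d : ℕ} {R : ℝ} (hR : 0 ≤ R + d - 1) :
    (0 : Fin d → ℤ) ∈ hyperbolicCross d R := by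
  rw [mem_hyperbolicCross hR]
  simp [crossLevel, dyadicLevel_zero]

theorem le_floor_level {d : ℕ} (hd : 2 ≤ d) (R : ℝ) : R ≤ (⌊R + d - 1⌋₊ : ℝ) := by
  have h := Nat.lt_floor_add_one (R + d - 1)
  have : (2 : ℝ) ≤ d := by exact_mod_cast hd
  linarith

theorem exists_samplingError_le {d : ℕ} (hd : 2 ≤ d) {α β γ : ℝ} (hα : 1 / 2 < α) (hβ : β ≤ 0)
    (hγ : 0 ≤ γ) (hαβγ : max γ (1 / 2) < α + β) :
    ∃ C : ℝ, 0 < C ∧ ∀ R : ℝ, 1 ≤ R → ∀ (z : Fin d → ℤ) (M : ℕ),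
      IsReconstructing z M (hyperbolicCross d R) →
        samplingError α β γ z M (hyperbolicCross d R) ≤
          ENNReal.ofReal (C * refinementRate d α β γ R) := by
  obtain ⟨hγ', hαβ⟩ := max_lt_iff.1 hαβγ
  obtain ⟨C₁, hC₁, hbound⟩ := exists_exponent_bound (d := d) hβ hαβ
  set s := α + β - γ with hs
  -- `A` is the constant of the truncation error and `B` that of the aliasing error.
  set A : ℝ := (4 ^ s) ^ d
  set B : ℝ := (2 ^ γ) ^ d * (3 ^ d * ((2 * d) ^ (-β) * (4 ^ α) ^ d) * d * C₁) with hB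
  have hA : 0 < A := by positivity
  have hB0 : 0 ≤ B := by positivity
  have hd' : (2 : ℝ) ≤ d := by exact_mod_cast hd
  have hdpow : (1 : ℝ) ≤ (d : ℝ) ^ (d - 1) := one_le_pow₀ (by linarith)
  refine ⟨Real.sqrt (2 * ((A + B) * d ^ (d - 1))), Real.sqrt_pos.2 (by positivity),
    fun R hR z M hrec => ?_⟩
  set T := ⌊R + d - 1⌋₊ with hT
  have hRd : 0 ≤ R + d - 1 := by linarith
  have hRT : R ≤ T := le_floor_level hd R
  have hT1 : 1 ≤ T := by
    have : (1 : ℝ) ≤ T := hR.trans hRT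
    exact_mod_cast this
  -- This uses `R ≥ 1` and converts `T^{d-1}` into a multiple of `R^{d-1}`.
  have hTd : (T : ℝ) ≤ d * R := by
    have := Nat.floor_le hRd
    nlinarith
  have h0 := zero_mem_hyperbolicCross (d := d) hRd
  have hM := hrec.pos ⟨_, h0⟩
  have hdual : ∀ h : Fin d → ℤ, crossLevel h ≤ T → (M : ℤ) ∣ ∑ s, h s * z s → h = 0 := by
    intro h hl hdvd
    exact hrec.eq_of_dvd ((mem_hyperbolicCross hRd).2 hl) h0 (by simpa using hdvd)
  have hρ : (1 : ℝ) ≤ logFactor d β T := by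
    unfold logFactor
    split_ifs
    · exact one_le_pow₀ (by exact_mod_cast hT1)
    · exact le_rfl
  set E : ℝ := (A + B) * ((4 : ℝ) ^ (-s)) ^ T * logFactor d β T with hE
  have hpow0 : (0 : ℝ) ≤ ((4 : ℝ) ^ (-s)) ^ T := by positivity
  have hEA : A * ((4 : ℝ) ^ (-s)) ^ T ≤ E := by
    calc A * ((4 : ℝ) ^ (-s)) ^ T ≤ (A + B) * ((4 : ℝ) ^ (-s)) ^ T := by gcongr; linarith
      _ ≤ _ := le_mul_of_one_le_right (by positivity) hρ
  have hEB : B * ((4 : ℝ) ^ (-s)) ^ T * logFactor d β T ≤ E := by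
    rw [hE]; gcongr; linarith
  have key : samplingError α β γ z M (hyperbolicCross d R) ≤
      (2 * ENNReal.ofReal E) ^ (1 / 2 : ℝ) := by
    refine iSup₂_le fun f hf => sobolevNorm_sub_latticeSampling_le hM
      (fun k hk k' hk' => hrec.eq_of_dvd hk hk') (tsum_inv_sobolevWeight_ne_top hβ hαβ) ?_ ?_ hf
    · intro k hk
      rw [mem_hyperbolicCross hRd, not_le] at hk
      rw [← ENNReal.ofReal_mul ((mul_nonneg hA.le hpow0).trans hEA)]
      refine ENNReal.ofReal_le_ofReal ((sobolevWeight_mixed_le hβ hγ'.le k).trans ?_)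
      refine mul_le_mul_of_nonneg_right (le_trans ?_ hEA) (sobolevWeight_pos _ _ _).le
      refine mul_le_mul_of_nonneg_left ?_ hA.le
      exact pow_le_pow_of_le_one (by positivity)
        (Real.rpow_le_one_of_one_le_of_nonpos (by norm_num) (by linarith)) hk.le
    · intro k hk
      obtain ⟨q, hq, hq0, hqα, hqb⟩ := hbound T hT1
      have hk' := (mem_hyperbolicCross hRd).1 hk
      -- An alias `h ≠ k` of a point `k` of the cross must lie outside the cross, so its level
      -- exceeds `T`.
      have h1 := tsum_coset_inv_sobolevWeight_le (by omega) (by linarith : 0 ≤ α) hβ hq hq0 hqα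
        hdual k (fun h => h ≠ k ∧ (M : ℤ) ∣ ∑ s, (h s - k s) * z s) (by
          rintro h ⟨hne, hdvd⟩
          refine ⟨?_, hdvd⟩
          by_contra hle
          exact hne (hrec.eq_of_dvd ((mem_hyperbolicCross hRd).2 (not_lt.1 hle)) hk hdvd))
      have h2 : sobolevWeight γ 0 k ≤ (2 ^ γ) ^ d * ((4 : ℝ) ^ γ) ^ T := by
        rw [sobolevWeight_zero_right]
        refine (prod_one_add_sq_rpow_le hγ k).trans ?_
        refine mul_le_mul_of_nonneg_left ?_ (by positivity)
        exact pow_le_pow_right₀ (Real.one_le_rpow (by norm_num) hγ) hk'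
      refine (mul_le_mul' (ENNReal.ofReal_le_ofReal h2) h1).trans ?_
      rw [← ENNReal.ofReal_mul (by positivity)]
      refine ENNReal.ofReal_le_ofReal (le_trans ?_ hEB)
      have h4 : ((4 : ℝ) ^ γ) ^ T * ((4 : ℝ) ^ (-(α + β))) ^ T = ((4 : ℝ) ^ (-s)) ^ T := by
        rw [← mul_pow, ← Real.rpow_add (by norm_num)]
        congr 2; rw [hs]; ring
      rw [← h4]
      calc _ = (2 ^ γ) ^ d * ((4 : ℝ) ^ γ) ^ T * (3 ^ d * ((2 * d) ^ (-β) * (4 ^ α) ^ d) * d) *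
            (((2 : ℝ) ^ (-(2 * α - q))) ^ T * (1 - (2 : ℝ) ^ (-(2 * α - 1 - q)))⁻¹ *
              ((1 - (2 : ℝ) ^ (-q))⁻¹) ^ (d - 1)) := by ring
        _ ≤ (2 ^ γ) ^ d * ((4 : ℝ) ^ γ) ^ T * (3 ^ d * ((2 * d) ^ (-β) * (4 ^ α) ^ d) * d) *
            (C₁ * ((4 : ℝ) ^ (-(α + β))) ^ T * logFactor d β T) :=
          mul_le_mul_of_nonneg_left hqb (by positivity)
        _ = _ := by rw [hB]; ring
  refine key.trans ?_
  have hrate0 : 0 ≤ refinementRate d α β γ R := by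
    unfold refinementRate; split_ifs <;> positivity
  have hER : E ≤ (A + B) * d ^ (d - 1) * refinementRate d α β γ R ^ 2 := by
    have e1 : ((4 : ℝ) ^ (-s)) ^ T ≤ ((2 : ℝ) ^ (-s * R)) ^ 2 := by
      rw [← Real.rpow_natCast, ← Real.rpow_natCast, ← Real.rpow_mul (by norm_num),
        ← Real.rpow_mul (by norm_num), show (4 : ℝ) = 2 ^ (2 : ℝ) by norm_num,
        ← Real.rpow_mul (by norm_num)]
      refine Real.rpow_le_rpow_of_exponent_le (by norm_num) ?_
      push_cast
      nlinarith [sub_pos.2 hγ']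
    have e2 : logFactor d β T ≤
        d ^ (d - 1) * (if β = 0 then R ^ (((d : ℝ) - 1) / 2) else 1) ^ 2 := by
      unfold logFactor
      split_ifs with hβ0
      · rw [← Real.rpow_natCast (R ^ _), ← Real.rpow_mul (by linarith)]
        have : ((d : ℝ) - 1) / 2 * ((2 : ℕ) : ℝ) = ((d - 1 : ℕ) : ℝ) := by
          rw [Nat.cast_sub (by omega)]; push_cast; ring
        rw [this, Real.rpow_natCast, ← mul_pow]
        gcongr
      · simpa using hdpow
    calc E ≤ (A + B) * ((2 : ℝ) ^ (-s * R)) ^ 2 *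
          (d ^ (d - 1) * (if β = 0 then R ^ (((d : ℝ) - 1) / 2) else 1) ^ 2) := by
          rw [hE]
          gcongr
      _ = _ := by rw [refinementRate]; ring
  calc (2 * ENNReal.ofReal E) ^ (1 / 2 : ℝ)
      ≤ (ENNReal.ofReal (2 * ((A + B) * d ^ (d - 1)) * refinementRate d α β γ R ^ 2)) ^
          (1 / 2 : ℝ) := by
        refine ENNReal.rpow_le_rpow ?_ (by norm_num)
        rw [show (2 : ℝ≥0∞) = ENNReal.ofReal 2 by norm_num, ← ENNReal.ofReal_mul (by norm_num)]
        refine ENNReal.ofReal_le_ofReal ?_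
        linarith
    _ = _ := by
        rw [ENNReal.ofReal_rpow_of_nonneg (by positivity) (by norm_num), ← Real.sqrt_eq_rpow,
          Real.sqrt_mul (by positivity), Real.sqrt_sq hrate0]

/-! ### The difference set of the hyperbolic cross -/

/-- Pick `a ∈ A` and `b ∉ A` and replace `u a`, `u b` by the two partial sums. The summand then
depends on these two variables only, each giving a geometric sum up to `T`; the other `d - 2`
variables give `T + 1` each. -/
theorem sum_two_pow_le {d T : ℕ} {A : Finset (Fin d)} (hA : A.Nonempty) (hA' : Aᶜ.Nonempty) :
    ∑ u ∈ (Fintype.piFinset fun _ : Fin d => Finset.range (T + 1)) with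
      ∑ s ∈ A, u s ≤ T ∧ ∑ s ∈ Aᶜ, u s ≤ T, 2 ^ (∑ s, u s) ≤ 4 * (T + 1) ^ (d - 2) * 4 ^ T := by
  obtain ⟨a, ha⟩ := hA
  obtain ⟨b, hb⟩ := hA'
  have hbA : b ∉ A := Finset.mem_compl.1 hb
  have hab : a ≠ b := fun h => hbA (h ▸ ha)
  let Φ : (Fin d → ℕ) → (Fin d → ℕ) := fun u =>
    Function.update (Function.update u a (∑ s ∈ A, u s)) b (∑ s ∈ Aᶜ, u s)
  have hΦa : ∀ u, Φ u a = ∑ s ∈ A, u s := fun u => by simp [Φ, hab]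
  have hΦb : ∀ u, Φ u b = ∑ s ∈ Aᶜ, u s := fun u => by simp [Φ]
  have hΦt : ∀ u t, t ≠ a → t ≠ b → Φ u t = u t := fun u t h1 h2 => by simp [Φ, h1, h2]
  have hΦ : Function.Injective Φ := by
    intro u v h
    have h1 : ∀ t, t ≠ a → t ≠ b → u t = v t := fun t h1 h2 => by
      rw [← hΦt u t h1 h2, ← hΦt v t h1 h2, h]
    have h2 : ∑ s ∈ A, u s = ∑ s ∈ A, v s := by rw [← hΦa, ← hΦa, h]
    have h3 : ∑ s ∈ Aᶜ, u s = ∑ s ∈ Aᶜ, v s := by rw [← hΦb, ← hΦb, h]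
    rw [← Finset.add_sum_erase A u ha, ← Finset.add_sum_erase A v ha,
      Finset.sum_congr rfl fun t ht => h1 t (Finset.ne_of_mem_erase ht)
        (fun h => hbA (h ▸ Finset.mem_of_mem_erase ht))] at h2
    rw [← Finset.add_sum_erase Aᶜ u hb, ← Finset.add_sum_erase Aᶜ v hb,
      Finset.sum_congr rfl fun t ht => h1 t
        (fun h => Finset.mem_compl.1 (Finset.mem_of_mem_erase ht) (h ▸ ha))
        (Finset.ne_of_mem_erase ht)] at h3
    ext t
    by_cases hta : t = a
    · rw [hta]; exact Nat.add_right_cancel h2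
    · by_cases htb : t = b
      · rw [htb]; exact Nat.add_right_cancel h3
      · exact h1 t hta htb
  let f : Fin d → ℕ → ℕ := fun t n => if t = a ∨ t = b then 2 ^ n else 1
  have hprod : ∀ F : Fin d → ℕ, ∏ t, F t = F a * F b * ∏ t ∈ (Finset.univ.erase a).erase b, F t := by
    intro F
    rw [← Finset.mul_prod_erase Finset.univ F (Finset.mem_univ a),
      ← Finset.mul_prod_erase (Finset.univ.erase a) F
        (Finset.mem_erase.2 ⟨hab.symm, Finset.mem_univ b⟩), mul_assoc]
  have hf : ∀ v : Fin d → ℕ, ∏ t, f t (v t) = 2 ^ (v a + v b) := by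
    intro v
    rw [hprod, Finset.prod_eq_one, pow_add]
    · simp [f]
    · intro t ht
      simp only [Finset.mem_erase] at ht
      simp [f, ht.1, ht.2.1]
  calc _ = ∑ u ∈ (Fintype.piFinset fun _ : Fin d => Finset.range (T + 1)) with
      ∑ s ∈ A, u s ≤ T ∧ ∑ s ∈ Aᶜ, u s ≤ T, ∏ t, f t (Φ u t) := by
        refine Finset.sum_congr rfl fun u _ => ?_
        rw [hf, hΦa, hΦb, Finset.sum_add_sum_compl]
    _ ≤ ∑ v ∈ Fintype.piFinset fun _ : Fin d => Finset.range (T + 1), ∏ t, f t (v t) := by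
        rw [← Finset.sum_image (f := fun v : Fin d → ℕ => ∏ t, f t (v t)) hΦ.injOn]
        refine Finset.sum_le_sum_of_subset fun v hv => ?_
        obtain ⟨u, hu, rfl⟩ := Finset.mem_image.1 hv
        rw [Finset.mem_filter, Fintype.mem_piFinset] at hu
        rw [Fintype.mem_piFinset]
        intro t
        by_cases hta : t = a
        · rw [hta, hΦa, Finset.mem_range]; omega
        · by_cases htb : t = b
          · rw [htb, hΦb, Finset.mem_range]; omega
          · rw [hΦt u t hta htb]; exact hu.1 t
    _ = ∏ t, ∑ n ∈ Finset.range (T + 1), f t n := (Finset.prod_univ_sum _ _).symm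
    _ ≤ 2 ^ (T + 1) * 2 ^ (T + 1) * (T + 1) ^ (d - 2) := by
        rw [hprod]
        refine Nat.mul_le_mul (Nat.mul_le_mul ?_ ?_) (le_of_eq ?_)
        · simpa [f] using (Nat.geomSum_lt (m := 2) le_rfl (n := T + 1)
            (s := Finset.range (T + 1)) fun k hk => Finset.mem_range.1 hk).le
        · simpa [f] using (Nat.geomSum_lt (m := 2) le_rfl (n := T + 1)
            (s := Finset.range (T + 1)) fun k hk => Finset.mem_range.1 hk).le
        · rw [Finset.prod_congr rfl (g := fun _ => T + 1), Finset.prod_const,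
            Finset.card_erase_of_mem (Finset.mem_erase.2 ⟨hab.symm, Finset.mem_univ b⟩),
            Finset.card_erase_of_mem (Finset.mem_univ a), Finset.card_univ, Fintype.card_fin,
            Nat.sub_sub]
          intro t ht
          simp only [Finset.mem_erase] at ht
          simp [f, ht.1, ht.2.1]
    _ = _ := by
        rw [show 4 ^ T = 2 ^ T * 2 ^ T by rw [← mul_pow]; norm_num]
        ring

theorem mem_differenceSet {d : ℕ} {I : Finset (Fin d → ℤ)} {k : Fin d → ℤ} :
    k ∈ differenceSet I ↔ ∃ h ∈ I, ∃ h' ∈ I, h - h' = k := by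
  simp [differenceSet, Finset.mem_image₂]

/-- Let `u` be the coordinatewise maximum of the levels of `h` and `h'`, and `A` the coordinates
where `h` attains it. Then `u` sums to at most `T` over `A` and over its complement, and `h - h'`
lies in a box of at most `5^d 2^{‖u‖₁}` points. There are at most `2^d` sets `A`. -/
theorem card_differenceSet_hyperbolicCross_le {d : ℕ} (hd : 2 ≤ d) {R : ℝ} (hR : 0 ≤ R + d - 1) :
    (differenceSet (hyperbolicCross d R)).card ≤
      2 ^ d * (5 ^ d * (4 * (⌊R + d - 1⌋₊ + 1) ^ (d - 2) * 4 ^ ⌊R + d - 1⌋₊)) := by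
  set T := ⌊R + d - 1⌋₊ with hT
  let U : Finset (Fin d) → Finset (Fin d → ℕ) := fun A =>
    (Fintype.piFinset fun _ : Fin d => Finset.range (T + 1)).filter fun u =>
      ∑ s ∈ A, u s ≤ T ∧ ∑ s ∈ Aᶜ, u s ≤ T
  let Box : (Fin d → ℕ) → Finset (Fin d → ℤ) := fun u =>
    Fintype.piFinset fun s => Finset.Icc (-2 ^ (u s + 1)) (2 ^ (u s + 1))
  let Q : Finset (Finset (Fin d)) := Finset.univ.filter fun A => A.Nonempty ∧ Aᶜ.Nonempty
  have hcover : differenceSet (hyperbolicCross d R) ⊆ Q.biUnion fun A => (U A).biUnion Box := by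
    intro k hk
    obtain ⟨h, hh, h', hh', rfl⟩ := mem_differenceSet.1 hk
    rw [mem_hyperbolicCross hR] at hh hh'
    let u : Fin d → ℕ := fun s => max (dyadicLevel (h s)) (dyadicLevel (h' s))
    have hbox : h - h' ∈ Box u := by
      rw [Fintype.mem_piFinset]
      intro s
      have e1 := (dyadicLevel_le_iff (n := h s) (j := u s)).1 (le_max_left _ _)
      have e2 := (dyadicLevel_le_iff (n := h' s) (j := u s)).1 (le_max_right _ _)
      rw [abs_le] at e1 e2
      rw [Finset.mem_Icc, pow_succ, Pi.sub_apply]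
      constructor <;> linarith [e1.1, e1.2, e2.1, e2.2]
    have hsub : ∀ (S : Finset (Fin d)) (j : Fin d → ℕ), (∀ s ∈ S, u s ≤ j s) → ∑ s, j s ≤ T →
        ∑ s ∈ S, u s ≤ T := fun S j hS hj =>
      ((Finset.sum_le_sum hS).trans (Finset.sum_le_sum_of_subset (Finset.subset_univ S))).trans hj
    have hex : ∃ A ∈ Q, ∑ s ∈ A, u s ≤ T ∧ ∑ s ∈ Aᶜ, u s ≤ T := by
      let A₀ : Finset (Fin d) := Finset.univ.filter fun s => dyadicLevel (h' s) ≤ dyadicLevel (h s)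
      have hA₀ : ∑ s ∈ A₀, u s ≤ T := by
        refine hsub A₀ (fun s => dyadicLevel (h s)) (fun s hs => ?_) hh
        exact max_le le_rfl (Finset.mem_filter.1 hs).2
      have hA₀' : ∑ s ∈ A₀ᶜ, u s ≤ T := by
        refine hsub A₀ᶜ (fun s => dyadicLevel (h' s)) (fun s hs => ?_) hh'
        simp only [A₀, Finset.mem_compl, Finset.mem_filter, Finset.mem_univ, true_and,
          not_le] at hs
        exact max_le hs.le le_rfl
      by_cases hne : A₀.Nonempty ∧ A₀ᶜ.Nonempty
      · exact ⟨A₀, by simp [Q, hne], hA₀, hA₀'⟩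
      -- When one vector dominates everywhere, all of `u` sums to at most `T`, so any proper
      -- nonempty `A` will do.
      · have hall : ∑ s, u s ≤ T := by
          rw [not_and_or, Finset.not_nonempty_iff_eq_empty, Finset.not_nonempty_iff_eq_empty,
            Finset.compl_eq_empty_iff] at hne
          rcases hne with hne | hne
          · simpa [hne] using hA₀'
          · simpa [hne] using hA₀
        have hle : ∀ S : Finset (Fin d), ∑ s ∈ S, u s ≤ T := fun S =>
          (Finset.sum_le_sum_of_subset (Finset.subset_univ S)).trans hall
        refine ⟨{⟨0, by omega⟩}, ?_, hle _, hle _⟩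
        simp only [Q, Finset.mem_filter, Finset.mem_univ, true_and]
        refine ⟨Finset.singleton_nonempty _, ⟨⟨1, by omega⟩, ?_⟩⟩
        simp
    obtain ⟨A, hA, hu⟩ := hex
    refine Finset.mem_biUnion.2 ⟨A, hA, Finset.mem_biUnion.2 ⟨u, ?_, hbox⟩⟩
    rw [Finset.mem_filter, Fintype.mem_piFinset]
    refine ⟨fun s => Finset.mem_range.2 (Nat.lt_succ_of_le ?_), hu⟩
    refine max_le ?_ ?_
    · exact (Finset.single_le_sum (f := fun s => dyadicLevel (h s)) (fun _ _ => Nat.zero_le _)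
        (Finset.mem_univ s)).trans hh
    · exact (Finset.single_le_sum (f := fun s => dyadicLevel (h' s)) (fun _ _ => Nat.zero_le _)
        (Finset.mem_univ s)).trans hh'
  have hBox : ∀ u, (Box u).card ≤ 5 ^ d * 2 ^ (∑ s, u s) := by
    intro u
    rw [Fintype.card_piFinset]
    calc _ ≤ ∏ s : Fin d, 5 * 2 ^ u s := by
          refine Finset.prod_le_prod' fun s _ => ?_
          rw [Int.card_Icc, Int.toNat_le]
          push_cast
          have : (1 : ℤ) ≤ 2 ^ u s := one_le_pow₀ (by norm_num)
          rw [pow_succ]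
          linarith
      _ = _ := by rw [Finset.prod_mul_distrib, Finset.prod_pow_eq_pow_sum]; simp
  refine (Finset.card_le_card hcover).trans (Finset.card_biUnion_le.trans ?_)
  calc ∑ A ∈ Q, ((U A).biUnion Box).card
      ≤ ∑ A ∈ Q, 5 ^ d * (4 * (T + 1) ^ (d - 2) * 4 ^ T) := by
        refine Finset.sum_le_sum fun A hA => ?_
        have hA' := (Finset.mem_filter.1 hA).2
        refine Finset.card_biUnion_le.trans ((Finset.sum_le_sum fun u _ => hBox u).trans ?_)
        rw [← Finset.mul_sum]
        exact Nat.mul_le_mul_left _ (sum_two_pow_le hA'.1 hA'.2)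
    _ ≤ _ := by
        rw [Finset.sum_const, smul_eq_mul]
        refine Nat.mul_le_mul_right _ ((Finset.card_le_univ _).trans ?_)
        simp

theorem crossLevel_single {d : ℕ} (s : Fin d) (n : ℤ) :
    crossLevel (Pi.single s n) = dyadicLevel n := by
  rw [crossLevel, Finset.sum_eq_single s]
  · simp
  · intro t _ ht
    simp [ht, dyadicLevel_zero]
  · simp

theorem single_mem_hyperbolicCross {d : ℕ} {R : ℝ} (hR : 0 ≤ R + d - 1) (s : Fin d) {n : ℤ}
    (hn : |n| ≤ 2 ^ ⌊R + d - 1⌋₊) : Pi.single s n ∈ hyperbolicCross d R := by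
  rw [mem_hyperbolicCross hR, crossLevel_single, dyadicLevel_le_iff]
  exact hn

theorem sum_single_mul {d : ℕ} (s : Fin d) (n : ℤ) (z : Fin d → ℤ) :
    ∑ t, (Pi.single s n : Fin d → ℤ) t * z t = n * z s := by
  simp [Pi.single_apply]

/-- The `2^T + 1` points `n e₁`, `0 ≤ n ≤ 2^T`, lie in the cross and need distinct residues `n z₁`
modulo `M`. -/
theorem two_pow_lt_of_isReconstructing {d : ℕ} (hd : 0 < d) {R : ℝ} (hR : 0 ≤ R + d - 1)
    {z : Fin d → ℤ} {M : ℕ} (h : IsReconstructing z M (hyperbolicCross d R)) :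
    2 ^ ⌊R + d - 1⌋₊ < M := by
  have hM := h.pos ⟨_, zero_mem_hyperbolicCross hR⟩
  have hM' : (0 : ℤ) < M := by exact_mod_cast hM
  by_contra hle
  let s : Fin d := ⟨0, hd⟩
  obtain ⟨n, hn, n', hn', hne, heq⟩ := Finset.exists_ne_map_eq_of_card_lt_of_maps_to
    (s := Finset.range (2 ^ ⌊R + d - 1⌋₊ + 1)) (t := Finset.Ico (0 : ℤ) M)
    (f := fun n => ((n : ℤ) * z s) % M) (by
      simp only [Finset.card_range, Int.card_Ico, sub_zero, Int.toNat_natCast]; omega)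
    (fun n _ => by
      rw [Finset.mem_coe, Finset.mem_Ico]
      exact ⟨Int.emod_nonneg _ hM'.ne', Int.emod_lt_of_pos _ hM'⟩)
  have hmem : ∀ n ∈ Finset.range (2 ^ ⌊R + d - 1⌋₊ + 1),
      (Pi.single s (n : ℤ) : Fin d → ℤ) ∈ hyperbolicCross d R := by
    intro n hn
    refine single_mem_hyperbolicCross hR s ?_
    rw [Finset.mem_range, Nat.lt_succ_iff] at hn
    rw [Nat.abs_cast]
    exact_mod_cast hn
  have h1 := h.eq_of_dvd (hmem n hn) (hmem n' hn') (by
    simp only [sub_mul, Finset.sum_sub_distrib, sum_single_mul]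
    exact Int.ModEq.dvd (Eq.symm heq))
  have := congrFun h1 s
  simp at this
  exact hne this

/-! ### Existence of lattices by the component-by-component construction -/

/-- A vector `k ∈ D` with `k s ≠ 0` excludes at most one residue for the new component `z s`,
because `P` is prime and exceeds `|k s|`. As `D` has fewer than `P` elements, some residue survives;
vectors with `k s = 0` are covered by the previous step. -/
theorem exists_component_by_component {d P : ℕ} (hP : P.Prime) (D : Finset (Fin d → ℤ))
    (hD : D.card < P) (hlt : ∀ k ∈ D, ∀ s, |k s| < (P : ℤ)) :
    ∃ z : Fin d → ℤ, (∀ s, 0 ≤ z s ∧ z s < (P : ℤ)) ∧ ∀ n, n ≤ d → ∀ k ∈ D,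
      (∃ i : Fin d, i.val < n ∧ k i ≠ 0) →
        ¬ (P : ℤ) ∣ ∑ i : Fin d with i.val < n, k i * z i := by
  have hP0 : (0 : ℤ) < P := by exact_mod_cast hP.pos
  have hPp : Prime (P : ℤ) := Nat.prime_iff_prime_int.1 hP
  suffices h : ∀ m, m ≤ d → ∃ z : Fin d → ℤ, (∀ s, 0 ≤ z s ∧ z s < (P : ℤ)) ∧ ∀ n, n ≤ m →
      ∀ k ∈ D, (∃ i : Fin d, i.val < n ∧ k i ≠ 0) →
        ¬ (P : ℤ) ∣ ∑ i : Fin d with i.val < n, k i * z i from h d le_rfl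
  intro m
  induction m with
  | zero =>
    refine fun _ => ⟨0, fun s => ⟨le_rfl, hP0⟩, ?_⟩
    rintro n hn k - ⟨i, hi, -⟩
    omega
  | succ m ih =>
    intro hm
    obtain ⟨z, hz, hzD⟩ := ih (by omega)
    let s : Fin d := ⟨m, by omega⟩
    have hgood : ∃ t ∈ Finset.range P, ∀ k ∈ D, k s ≠ 0 →
        ¬ (P : ℤ) ∣ (∑ i : Fin d with i.val < m, k i * z i) + k s * t := by
      by_contra hcon
      push Not at hcon
      -- If every residue `t` were excluded by some `κ t ∈ D`, two residues would share the same
      -- vector.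
      choose! κ hκ hκ0 hκd using hcon
      obtain ⟨t, ht, t', ht', hne, heq⟩ := Finset.exists_ne_map_eq_of_card_lt_of_maps_to
        (s := Finset.range P) (t := D) (f := κ) (by simpa using hD) hκ
      have h1 := hκd t ht
      have h2 := hκd t' ht'
      rw [← heq] at h2
      have h3 := dvd_sub h1 h2
      rw [add_sub_add_left_eq_sub, ← mul_sub] at h3
      rw [Finset.mem_range] at ht ht'
      rcases hPp.dvd_or_dvd h3 with h4 | h4
      · exact hκ0 t (Finset.mem_range.2 ht)
          (Int.eq_zero_of_abs_lt_dvd h4 (hlt _ (hκ t (Finset.mem_range.2 ht)) s))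
      · have h5 : (t : ℤ) - t' = 0 := Int.eq_zero_of_abs_lt_dvd h4 (by rw [abs_lt]; omega)
        omega
    obtain ⟨t, ht, hgood⟩ := hgood
    rw [Finset.mem_range] at ht
    have hsum : ∀ n ≤ m, ∀ k : Fin d → ℤ,
        ∑ i : Fin d with i.val < n, k i * Function.update z s (t : ℤ) i =
          ∑ i : Fin d with i.val < n, k i * z i := by
      intro n hn k
      refine Finset.sum_congr rfl fun i hi => ?_
      have : i ≠ s := by
        rintro rfl
        have := (Finset.mem_filter.1 hi).2
        simp [s] at this
        omega
      rw [Function.update_of_ne this]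
    refine ⟨Function.update z s t, fun i => ?_, fun n hn k hk hex => ?_⟩
    · by_cases hi : i = s
      · subst hi; simp [ht]
      · rw [Function.update_of_ne hi]; exact hz i
    · rcases Nat.lt_or_ge m n with hmn | hmn
      · obtain rfl : n = m + 1 := by omega
        have hfil : (Finset.univ.filter fun i : Fin d => i.val < m + 1) =
            insert s (Finset.univ.filter fun i : Fin d => i.val < m) := by
          ext i
          simp only [Finset.mem_filter, Finset.mem_univ, true_and, Finset.mem_insert, s,
            Fin.ext_iff]
          omega
        rw [hfil, Finset.sum_insert (by simp [s]), hsum m le_rfl, Function.update_self, add_comm]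
        by_cases hks : k s = 0
        · rw [hks, zero_mul, add_zero]
          obtain ⟨i, hi, hki⟩ := hex
          refine hzD m le_rfl k hk ⟨i, ?_, hki⟩
          have : i ≠ s := fun h => hki (h ▸ hks)
          have : i.val ≠ m := fun h => this (Fin.ext h)
          omega
        · exact hgood k hk hks
      · rw [hsum n hmn]
        exact hzD n hmn k hk hex

/-- Bertrand's postulate gives a prime `P` with `|D| < P ≤ 2|D|`. One axis alone contributes `2 ·
2^T + 1` points to `D`, so `P` also exceeds every coordinate in `D`. The final size reduction is
left out: `M = P`. -/
theorem exists_isCBCLattice {d : ℕ} (hd : 2 ≤ d) {κ : ℝ} (hκ : 2 ≤ κ) {R : ℝ} (hR : 1 ≤ R) :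
    ∃ (z : Fin d → ℤ) (M : ℕ), IsCBCLattice κ (hyperbolicCross d R) z M := by
  have hd' : (2 : ℝ) ≤ d := by exact_mod_cast hd
  have hRd : 0 ≤ R + d - 1 := by linarith
  set I := hyperbolicCross d R with hI
  set T := ⌊R + d - 1⌋₊ with hT
  have h0 : (0 : Fin d → ℤ) ∈ I := zero_mem_hyperbolicCross hRd
  have hcard : 2 * 2 ^ T + 1 ≤ (differenceSet I).card := by
    have : (Finset.Icc (-2 ^ T : ℤ) (2 ^ T)).card = 2 * 2 ^ T + 1 := by
      rw [Int.card_Icc]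
      have : (2 : ℤ) ^ T + 1 - -2 ^ T = ((2 * 2 ^ T + 1 : ℕ) : ℤ) := by push_cast; ring
      rw [this, Int.toNat_natCast]
    rw [← this]
    refine Finset.card_le_card_of_injOn (fun n => Pi.single (⟨0, by omega⟩ : Fin d) n) ?_ ?_
    · intro n hn
      rw [Finset.mem_coe, Finset.mem_Icc] at hn
      exact mem_differenceSet.2 ⟨_, single_mem_hyperbolicCross hRd _ (abs_le.2 hn), 0, h0,
        sub_zero _⟩
    · exact fun n _ n' _ h => Pi.single_injective _ h
  have hbd : ∀ k ∈ differenceSet I, ∀ s, |k s| ≤ 2 * 2 ^ T := by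
    have hb : ∀ h ∈ I, ∀ s, |h s| ≤ 2 ^ T := by
      intro h hh s
      rw [← dyadicLevel_le_iff]
      exact (Finset.single_le_sum (f := fun s => dyadicLevel (h s)) (fun _ _ => Nat.zero_le _)
        (Finset.mem_univ s)).trans ((mem_hyperbolicCross hRd).1 hh)
    intro k hk s
    obtain ⟨h, hh, h', hh', rfl⟩ := mem_differenceSet.1 hk
    refine (abs_sub (h s) (h' s)).trans ?_
    linarith [hb h hh s, hb h' hh' s]
  obtain ⟨P, hP, hDP, hPD⟩ := Nat.exists_prime_lt_and_le_two_mul (differenceSet I).card (by omega)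
  have hlt : ∀ k ∈ differenceSet I, ∀ s, |k s| < (P : ℤ) := by
    intro k hk s
    refine (hbd k hk s).trans_lt ?_
    exact_mod_cast (by omega : 2 * 2 ^ T < P)
  obtain ⟨z, hz, hzD⟩ := exists_component_by_component hP (differenceSet I) hDP hlt
  have hproj : ∀ (s : ℕ) (hs : s ≤ d),
      IsReconstructing (fun i : Fin s => z (Fin.castLE hs i)) P (projectFirst s hs I) := by
    intro s hs
    refine isReconstructing_of_injective hP.pos ?_
    intro k hk k' hk' hdvd
    obtain ⟨h, hh, rfl⟩ := Finset.mem_image.1 hk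
    obtain ⟨h', hh', rfl⟩ := Finset.mem_image.1 hk'
    by_contra hne
    refine hzD s hs (h - h') (mem_differenceSet.2 ⟨h, hh, h', hh', rfl⟩) ?_ ?_
    · obtain ⟨i, hi⟩ := Function.ne_iff.1 hne
      exact ⟨Fin.castLE hs i, i.isLt, sub_ne_zero.2 hi⟩
    · convert hdvd using 1
      symm
      refine Finset.sum_bij (fun i _ => Fin.castLE hs i) ?_ ?_ ?_ ?_
      · intro i _; simp
      · intro i _ j _ hij; exact Fin.castLE_injective hs hij
      · intro i hi
        exact ⟨⟨i.val, (Finset.mem_filter.1 hi).2⟩, Finset.mem_univ _, Fin.ext rfl⟩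
      · intro i _; rfl
  refine ⟨z, P, P, hP, by omega, hlt, ?_, hz, fun s hs _ => hproj s hs, le_rfl, ?_⟩
  · have : (P : ℝ) ≤ 2 * (differenceSet I).card := by exact_mod_cast hPD
    refine this.trans ?_
    gcongr
  · have := hproj d le_rfl
    simpa [projectFirst] using this

/-! ### Lower bound -/

/-- Thue's argument: with `N = ⌊√M⌋` there are `(N + 1)² > M` pairs in `{0, …, N}²`, so two of them
have the same residue. -/
theorem exists_dual_pair {d : ℕ} (a b : Fin d) (z : Fin d → ℤ) {M : ℕ} (hM : 0 < M) :
    ∃ m n : ℤ, (m ≠ 0 ∨ n ≠ 0) ∧ m ^ 2 ≤ M ∧ n ^ 2 ≤ M ∧ (M : ℤ) ∣ m * z a + n * z b := by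
  have hM' : (0 : ℤ) < M := by exact_mod_cast hM
  set N := Nat.sqrt M with hN
  have hN1 : M < (N + 1) * (N + 1) := Nat.lt_succ_sqrt M
  have hN2 : N * N ≤ M := Nat.sqrt_le M
  obtain ⟨p, hp, q, hq, hne, heq⟩ := Finset.exists_ne_map_eq_of_card_lt_of_maps_to
    (s := Finset.range (N + 1) ×ˢ Finset.range (N + 1)) (t := Finset.Ico (0 : ℤ) M)
    (f := fun p => ((p.1 : ℤ) * z a + (p.2 : ℤ) * z b) % M) (by
      simp only [Finset.card_product, Finset.card_range, Int.card_Ico, sub_zero,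
        Int.toNat_natCast]
      exact hN1)
    (fun p _ => by
      rw [Finset.mem_coe, Finset.mem_Ico]
      exact ⟨Int.emod_nonneg _ hM'.ne', Int.emod_lt_of_pos _ hM'⟩)
  rw [Finset.mem_product, Finset.mem_range, Finset.mem_range] at hp hq
  have hsq : ∀ x y : ℕ, x < N + 1 → y < N + 1 → ((x : ℤ) - y) ^ 2 ≤ M := by
    intro x y hx hy
    have h1 : |(x : ℤ) - y| ≤ N := by rw [abs_le]; omega
    have h2 : |(x : ℤ) - y| ^ 2 ≤ (N : ℤ) ^ 2 := by gcongr
    rw [sq_abs] at h2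
    refine h2.trans ?_
    rw [sq]
    exact_mod_cast hN2
  refine ⟨(p.1 : ℤ) - q.1, (p.2 : ℤ) - q.2, ?_, hsq _ _ hp.1 hq.1, hsq _ _ hp.2 hq.2, ?_⟩
  · by_contra hcon
    push Not at hcon
    exact hne (Prod.ext (by omega) (by omega))
  · have := Int.ModEq.dvd (Eq.symm heq)
    convert this using 1
    ring

theorem sobolevWeight_single {d : ℕ} (α β : ℝ) (s : Fin d) (n : ℤ) :
    sobolevWeight α β (Pi.single s n) = (1 + (n : ℝ) ^ 2) ^ (α + β) := by
  have h1 : ∑ t, ((Pi.single s n : Fin d → ℤ) t : ℝ) ^ 2 = (n : ℝ) ^ 2 := by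
    rw [Finset.sum_eq_single s]
    · simp
    · intro t _ ht; simp [ht]
    · simp
  have h2 : ∏ t, (1 + ((Pi.single s n : Fin d → ℤ) t : ℝ) ^ 2) ^ α = (1 + (n : ℝ) ^ 2) ^ α := by
    rw [Finset.prod_eq_single s]
    · simp
    · intro t _ ht; simp [ht]
    · simp
  rw [sobolevWeight, h1, h2, ← Real.rpow_add (one_add_sq_pos n), add_comm β]

theorem sobolevNorm_smul_sub {d : ℕ} (α β : ℝ) {k k' : Fin d → ℤ} (hne : k ≠ k') {c : ℝ}
    (hc : 0 ≤ c) :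
    sobolevNorm α β (toL2 ((c : ℂ) • (UnitAddTorus.mFourier k - UnitAddTorus.mFourier k'))) =
      ENNReal.ofReal (c * Real.sqrt (sobolevWeight α β k + sobolevWeight α β k')) := by
  have hcoef : ∀ l, fourierCoefficient
      (toL2 ((c : ℂ) • (UnitAddTorus.mFourier k - UnitAddTorus.mFourier k'))) l =
      c * ((if l = k then 1 else 0) - if l = k' then 1 else 0) := by
    intro l
    rw [← toL2CLM_apply, map_smul, map_sub, fourierCoefficient_smul, fourierCoefficient_sub,
      toL2CLM_apply, toL2CLM_apply, fourierCoefficient_mFourier, fourierCoefficient_mFourier]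
  have hw := sobolevWeight_pos α β k
  have hw' := sobolevWeight_pos α β k'
  have hcn : ‖(c : ℂ)‖ₑ ^ 2 = ENNReal.ofReal (c ^ 2) := by
    rw [← ofReal_norm, Complex.norm_real, Real.norm_of_nonneg hc, ENNReal.ofReal_pow hc]
  rw [sobolevNorm, tsum_eq_sum (s := {k, k'}), Finset.sum_pair hne, hcoef, hcoef]
  · simp only [if_true, if_neg hne, if_neg hne.symm, sub_zero, mul_one, zero_sub, mul_neg,
      enorm_neg, hcn]
    rw [← ENNReal.ofReal_mul hw.le, ← ENNReal.ofReal_mul hw'.le,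
      ← ENNReal.ofReal_add (by positivity) (by positivity),
      ENNReal.ofReal_rpow_of_nonneg (by positivity) (by norm_num), ← Real.sqrt_eq_rpow,
      ← add_mul, mul_comm, Real.sqrt_mul (by positivity), Real.sqrt_sq hc]
  · intro l hl
    rw [Finset.mem_insert, Finset.mem_singleton, not_or] at hl
    rw [hcoef, if_neg hl.1, if_neg hl.2]
    simp

/-- A normalised difference of two aliasing exponentials has all lattice coefficients zero, so its
error is its own norm. Placing the frequencies on the axes makes the source weight `(1 + n²)^{α+β}`,
with no loss from the isotropic factor. -/
theorem le_samplingError {d : ℕ} (hd : 2 ≤ d) {α β γ : ℝ} (hαβγ : γ < α + β)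
    {z : Fin d → ℤ} {M : ℕ} (hM : 0 < M) (I : Finset (Fin d → ℤ)) :
    ENNReal.ofReal ((2 : ℝ) ^ (-(α + β - γ) / 2) * (M : ℝ) ^ (-(α + β - γ) / 2)) ≤
      samplingError α β γ z M I := by
  let a : Fin d := ⟨0, by omega⟩
  let b : Fin d := ⟨1, by omega⟩
  have hab : a ≠ b := by simp [a, b, Fin.ext_iff]
  obtain ⟨m, n, hmn, hm, hn, hdvd⟩ := exists_dual_pair a b z hM
  set k : Fin d → ℤ := Pi.single a m with hk
  set k' : Fin d → ℤ := Pi.single b (-n) with hk'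
  have hne : k ≠ k' := by
    intro h
    have h1 := congrFun h a
    have h2 := congrFun h b
    simp [hk, hk', hab, hab.symm] at h1 h2
    omega
  have hW := add_pos (sobolevWeight_pos α β k) (sobolevWeight_pos α β k')
  set W := sobolevWeight α β k + sobolevWeight α β k' with hWdef
  set c : ℝ := (Real.sqrt W)⁻¹ with hc
  have hc0 : 0 ≤ c := by positivity
  set g : C(Torus d, ℂ) := (c : ℂ) • (UnitAddTorus.mFourier k - UnitAddTorus.mFourier k') with hg
  have hnorm : sobolevNorm α β (toL2 g) ≤ 1 := by
    rw [sobolevNorm_smul_sub α β hne hc0, hc, inv_mul_cancel₀ (Real.sqrt_pos.2 hW).ne']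
    simp
  have hS : latticeSampling z M I (continuousRep (toL2 g)) = 0 := by
    rw [continuousRep_toL2, latticeSampling]
    refine Finset.sum_eq_zero fun l _ => ?_
    have h0 : latticeCoefficient z M g l = 0 := by
      rw [← latticeCoefficientCLM_apply, map_smul, map_sub, latticeCoefficientCLM_apply,
        latticeCoefficientCLM_apply, latticeCoefficient_mFourier z hM,
        latticeCoefficient_mFourier z hM]
      have hiff : (M : ℤ) ∣ ∑ s, (k s - l s) * z s ↔ (M : ℤ) ∣ ∑ s, (k' s - l s) * z s := by
        have hsub : ∑ s, (k s - l s) * z s - ∑ s, (k' s - l s) * z s = m * z a + n * z b := by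
          simp only [sub_mul, Finset.sum_sub_distrib]
          rw [hk, hk', sum_single_mul, sum_single_mul]
          ring
        exact dvd_iff_dvd_of_dvd_sub (by rw [hsub]; exact hdvd)
      simp [hiff]
    rw [h0]
    ext x; exact zero_mul _
  refine le_trans ?_ (le_iSup₂_of_le (toL2 g) hnorm le_rfl)
  have hz : toL2 (0 : C(Torus d, ℂ)) = 0 := map_zero (toL2CLM d)
  rw [hS, hz, sub_zero, sobolevNorm_smul_sub γ 0 hne hc0]
  refine ENNReal.ofReal_le_ofReal ?_
  set s := α + β - γ with hs
  have hM1 : (1 : ℝ) ≤ M := by exact_mod_cast hM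
  -- Here `1 + x² ≤ 1 + M ≤ 2M`.
  have hwt : ∀ x : ℤ, x ^ 2 ≤ M → (2 * (M : ℝ)) ^ (-s) * (1 + (x : ℝ) ^ 2) ^ (α + β) ≤
      (1 + (x : ℝ) ^ 2) ^ (γ + 0) := by
    intro x hx
    have hx' : (x : ℝ) ^ 2 ≤ M := by exact_mod_cast hx
    calc _ ≤ (1 + (x : ℝ) ^ 2) ^ (-s) * (1 + (x : ℝ) ^ 2) ^ (α + β) := by
          refine mul_le_mul_of_nonneg_right ?_ (by positivity)
          exact Real.rpow_le_rpow_of_nonpos (one_add_sq_pos x) (by linarith) (by linarith)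
      _ = _ := by
          rw [← Real.rpow_add (one_add_sq_pos x)]
          congr 1; rw [hs]; ring
  have hV : (2 * (M : ℝ)) ^ (-s) * W ≤ sobolevWeight γ 0 k + sobolevWeight γ 0 k' := by
    rw [hWdef, hk, hk']
    simp only [sobolevWeight_single]
    rw [mul_add]
    exact add_le_add (hwt m hm) (hwt (-n) (by rwa [neg_sq]))
  calc _ = Real.sqrt ((2 * (M : ℝ)) ^ (-s)) := by
        rw [← Real.mul_rpow (by norm_num) (by positivity), Real.sqrt_eq_rpow,
          ← Real.rpow_mul (by positivity)]
        congr 1; ring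
    _ = c * Real.sqrt ((2 * (M : ℝ)) ^ (-s) * W) := by
        rw [hc, Real.sqrt_mul (by positivity), mul_left_comm,
          inv_mul_cancel₀ (Real.sqrt_pos.2 hW).ne', mul_one]
    _ ≤ _ := mul_le_mul_of_nonneg_left (Real.sqrt_le_sqrt hV) hc0

/-! ### Rates in terms of the lattice size -/

/-- The size of the difference set gives `M ≤ K R^{d-2} 2^{2R}`, which is solved for `2^{-R}`; the
powers of `R` are then replaced by powers of `log M` using `2^R ≤ M`. -/
theorem exists_refinementRate_le {d : ℕ} (hd : 2 ≤ d) {α β γ : ℝ} (hαβγ : γ < α + β) (κ : ℝ) :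
    ∃ C : ℝ, 0 < C ∧ ∀ R : ℝ, 1 ≤ R → ∀ (z : Fin d → ℤ) (M : ℕ),
      IsCBCLattice κ (hyperbolicCross d R) z M →
        refinementRate d α β γ R ≤ C * latticeSizeRate d α β γ M := by
  set s := α + β - γ with hs
  have hs0 : 0 < s := sub_pos.2 hαβγ
  have hd' : (2 : ℝ) ≤ d := by exact_mod_cast hd
  have hlog2 : 0 < Real.log 2 := Real.log_pos (by norm_num)
  -- `max κ 1` keeps `K` positive for every real `κ`; `d + 1` comes from `T + 1 ≤ R + d ≤ (d + 1)
  -- R`, and `4^{d-1}` from `T ≤ R + d - 1`.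
  set K : ℝ := max κ 1 * (2 ^ d * (5 ^ d * (4 * (d + 1) ^ (d - 2) * 4 ^ (d - 1)))) with hK
  have hκ0 : 0 < max κ 1 := lt_max_of_lt_right one_pos
  have hK0 : 0 < K := by positivity
  set e : ℝ := ((d : ℝ) - 2) / 2 * s with he
  have he0 : 0 ≤ e := by positivity [sub_nonneg.2 hd']
  set L : ℝ := (Real.log 2)⁻¹ ^ (((d : ℝ) - 1) / 2) with hL
  have hL0 : 0 < L := by positivity
  refine ⟨K ^ (s / 2) * (Real.log 2)⁻¹ ^ e * max L 1, by positivity, ?_⟩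
  rintro R hR z M ⟨P, -, -, -, hPκ, -, -, hMP, hrec⟩
  have hR0 : 0 < R := by linarith
  have hRd : 0 ≤ R + d - 1 := by linarith
  set T := ⌊R + d - 1⌋₊ with hT
  have hRT : R ≤ T := le_floor_level hd R
  have hTR : (T : ℝ) ≤ R + d - 1 := Nat.floor_le hRd
  have h2M : 2 ^ T < M := two_pow_lt_of_isReconstructing (by omega) hRd hrec
  have hM0 : (0 : ℝ) < M := by exact_mod_cast (Nat.zero_le _).trans_lt h2M
  have hlogM : R * Real.log 2 ≤ Real.log M := by
    calc R * Real.log 2 ≤ T * Real.log 2 := by gcongr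
      _ = Real.log (2 ^ T) := by rw [Real.log_pow]
      _ ≤ Real.log M := Real.log_le_log (by positivity) (by exact_mod_cast h2M.le)
  have hlogM' : R ≤ (Real.log 2)⁻¹ * Real.log M := by
    rw [inv_mul_eq_div, le_div_iff₀ hlog2]; exact hlogM
  have hlogM0 : 0 < Real.log M := lt_of_lt_of_le (by positivity) hlogM
  have hMK : (M : ℝ) ≤ K * R ^ ((d : ℝ) - 2) * (2 : ℝ) ^ (2 * R) := by
    have h1 : (M : ℝ) ≤ P := by exact_mod_cast hMP
    have h2 : ((differenceSet (hyperbolicCross d R)).card : ℝ) ≤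
        2 ^ d * (5 ^ d * (4 * (T + 1) ^ (d - 2) * 4 ^ T)) := by
      exact_mod_cast card_differenceSet_hyperbolicCross_le hd hRd
    have h3 : ((T : ℝ) + 1) ^ (d - 2) ≤ (d + 1) ^ (d - 2) * R ^ ((d : ℝ) - 2) := by
      have : R ^ ((d : ℝ) - 2) = R ^ (d - 2) := by
        rw [← Real.rpow_natCast, Nat.cast_sub hd]; norm_num
      rw [this, ← mul_pow]
      refine pow_le_pow_left₀ (by positivity) ?_ _
      nlinarith
    have h4 : (4 : ℝ) ^ T ≤ 4 ^ (d - 1) * 2 ^ (2 * R) := by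
      have e1 : (2 : ℝ) ^ (2 * R) = 4 ^ R := by
        rw [Real.rpow_mul (by norm_num)]; norm_num
      rw [e1, ← Real.rpow_natCast, ← Real.rpow_natCast, ← Real.rpow_add (by norm_num)]
      refine Real.rpow_le_rpow_of_exponent_le (by norm_num) ?_
      rw [Nat.cast_sub (by omega)]
      push_cast
      linarith
    calc (M : ℝ) ≤ κ * ((differenceSet (hyperbolicCross d R)).card : ℝ) := h1.trans hPκ
      _ ≤ max κ 1 * ((differenceSet (hyperbolicCross d R)).card : ℝ) := by
          gcongr; exact le_max_left _ _
      _ ≤ max κ 1 * (2 ^ d * (5 ^ d * (4 * (T + 1) ^ (d - 2) * 4 ^ T))) := by gcongr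
      _ ≤ max κ 1 * (2 ^ d * (5 ^ d * (4 * ((d + 1) ^ (d - 2) * R ^ ((d : ℝ) - 2)) *
            (4 ^ (d - 1) * 2 ^ (2 * R))))) := by gcongr
      _ = _ := by rw [hK]; ring
  have hmain : (2 : ℝ) ^ (-s * R) ≤ K ^ (s / 2) * (Real.log 2)⁻¹ ^ e *
      ((M : ℝ) ^ (-s / 2) * Real.log M ^ e) := by
    have h1 : (M : ℝ) ^ (s / 2) ≤ K ^ (s / 2) * R ^ e * (2 : ℝ) ^ (s * R) := by
      calc (M : ℝ) ^ (s / 2) ≤ (K * R ^ ((d : ℝ) - 2) * (2 : ℝ) ^ (2 * R)) ^ (s / 2) :=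
            Real.rpow_le_rpow hM0.le hMK (by positivity)
        _ = _ := by
            rw [Real.mul_rpow (by positivity) (by positivity),
              Real.mul_rpow (by positivity) (by positivity), ← Real.rpow_mul hR0.le,
              ← Real.rpow_mul (by norm_num)]
            congr 2
            · congr 1; rw [he]; ring
            · ring
    have h2 : R ^ e ≤ (Real.log 2)⁻¹ ^ e * Real.log M ^ e := by
      rw [← Real.mul_rpow (by positivity) hlogM0.le]
      exact Real.rpow_le_rpow hR0.le hlogM' he0
    have h3 : (M : ℝ) ^ (-s / 2) * (M : ℝ) ^ (s / 2) = 1 := by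
      rw [← Real.rpow_add hM0]; ring_nf; simp
    have h4 : (2 : ℝ) ^ (-s * R) * (2 : ℝ) ^ (s * R) = 1 := by
      rw [← Real.rpow_add (by norm_num)]; ring_nf; simp
    calc (2 : ℝ) ^ (-s * R)
        = (2 : ℝ) ^ (-s * R) * (M : ℝ) ^ (-s / 2) * (M : ℝ) ^ (s / 2) := by
          rw [mul_assoc, h3, mul_one]
      _ ≤ (2 : ℝ) ^ (-s * R) * (M : ℝ) ^ (-s / 2) *
          (K ^ (s / 2) * ((Real.log 2)⁻¹ ^ e * Real.log M ^ e) * (2 : ℝ) ^ (s * R)) := by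
          refine mul_le_mul_of_nonneg_left (h1.trans ?_) (by positivity)
          gcongr
      _ = K ^ (s / 2) * (Real.log 2)⁻¹ ^ e * ((M : ℝ) ^ (-s / 2) * Real.log M ^ e) *
          ((2 : ℝ) ^ (-s * R) * (2 : ℝ) ^ (s * R)) := by ring
      _ = _ := by rw [h4, mul_one]
  have hfac : (if β = 0 then R ^ (((d : ℝ) - 1) / 2) else 1) ≤
      max L 1 * (if β = 0 then Real.log M ^ (((d : ℝ) - 1) / 2) else 1) := by
    split_ifs
    · calc R ^ (((d : ℝ) - 1) / 2) ≤ ((Real.log 2)⁻¹ * Real.log M) ^ (((d : ℝ) - 1) / 2) :=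
            Real.rpow_le_rpow hR0.le hlogM' (by linarith)
        _ = L * Real.log M ^ (((d : ℝ) - 1) / 2) := by
            rw [Real.mul_rpow (by positivity) hlogM0.le]
        _ ≤ _ := by gcongr; exact le_max_left _ _
    · rw [mul_one]; exact le_max_right _ _
  rw [refinementRate, latticeSizeRate]
  calc _ ≤ K ^ (s / 2) * (Real.log 2)⁻¹ ^ e * ((M : ℝ) ^ (-s / 2) * Real.log M ^ e) *
        (max L 1 * (if β = 0 then Real.log M ^ (((d : ℝ) - 1) / 2) else 1)) := by
        refine mul_le_mul hmain hfac ?_ (by positivity)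
        split_ifs <;> positivity
    _ = _ := by ring

end

/-! ### The theorem -/

theorem mainTheorem4 (d : ℕ) (hd : 2 ≤ d) (α β γ : ℝ) (hα : 1 / 2 < α) (hβ : β ≤ 0) (hγ : 0 ≤ γ)
    (hαβγ : max γ (1 / 2) < α + β) :
    -- two-sided estimate for every reconstructing lattice
    (∃ c C : ℝ, 0 < c ∧ 0 < C ∧ ∀ R : ℝ, 1 ≤ R → ∀ (z : Fin d → ℤ) (M : ℕ),
      IsReconstructing z M (hyperbolicCross d R) →
        ENNReal.ofReal (c * (M : ℝ) ^ (-(α + β - γ) / 2)) ≤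
            samplingError α β γ z M (hyperbolicCross d R) ∧
          samplingError α β γ z M (hyperbolicCross d R) ≤
            ENNReal.ofReal (C * refinementRate d α β γ R)) ∧
    -- continuation of the upper estimate for lattices constructed component by component
    (∀ κ : ℝ, ∃ C : ℝ, 0 < C ∧ ∀ R : ℝ, 1 ≤ R → ∀ (z : Fin d → ℤ) (M : ℕ),
      IsCBCLattice κ (hyperbolicCross d R) z M →
        refinementRate d α β γ R ≤ C * latticeSizeRate d α β γ M ∧
          samplingError α β γ z M (hyperbolicCross d R) ≤
            ENNReal.ofReal (C * latticeSizeRate d α β γ M)) ∧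
    -- such lattices exist
    (∀ κ : ℝ, 2 ≤ κ → ∀ R : ℝ, 1 ≤ R → ∃ (z : Fin d → ℤ) (M : ℕ),
      IsCBCLattice κ (hyperbolicCross d R) z M) := by
  have hγ' : γ < α + β := (max_lt_iff.1 hαβγ).1
  obtain ⟨C, hC, hupper⟩ := exists_samplingError_le hd hα hβ hγ hαβγ
  refine ⟨⟨2 ^ (-(α + β - γ) / 2), C, by positivity, hC,
      fun R hR z M hrec => ⟨?_, hupper R hR z M hrec⟩⟩,
    fun κ => ?_, fun κ hκ R hR => exists_isCBCLattice hd hκ hR⟩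
  · have hd' : (2 : ℝ) ≤ d := by exact_mod_cast hd
    exact le_samplingError hd hγ' (hrec.pos ⟨_, zero_mem_hyperbolicCross (by linarith)⟩) _
  · obtain ⟨C', hC', hrate⟩ := exists_refinementRate_le hd hγ' κ
    -- One constant serves both claims: `C'` for the rate itself, `C * C'` for the operator norm.
    refine ⟨max C' (C * C'), lt_max_of_lt_left hC', fun R hR z M hcbc => ?_⟩
    have h0 : 0 ≤ latticeSizeRate d α β γ M := by
      have := Real.log_natCast_nonneg M
      unfold latticeSizeRate
      split_ifs <;> positivity
    have h1 := hrate R hR z M hcbc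
    refine ⟨h1.trans (mul_le_mul_of_nonneg_right (le_max_left _ _) h0), ?_⟩
    obtain ⟨P, -, -, -, -, -, -, -, hrec⟩ := hcbc
    refine (hupper R hR z M hrec).trans (ENNReal.ofReal_le_ofReal ?_)
    calc C * refinementRate d α β γ R ≤ C * (C' * latticeSizeRate d α β γ M) := by gcongr
      _ = C * C' * latticeSizeRate d α β γ M := by ring
      _ ≤ _ := mul_le_mul_of_nonneg_right (le_max_right _ _) h0
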